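/- **Boundedness of the gradient function.** Let $\mathrm{NN}_w:\mathbb{R}^m\to\mathbb{R}^d$, $w\in\mathbb{R}^p$, be a feed-forward neural network, i.e. a finite composition of layers $h\mapsto\sigma_\ell(W_\ell(w)h+b_\ell(w))$ whose weight matrices $W_\ell(w)$ and biases $b_\ell(w)$ depend linearly on the parameter vector $w$ (dense layers, shared weights such as convolutions, and absent biases are all included). Let $\theta=(w,\Sigma)$, where $\Sigma$ is a diagonal $d\times d$ matrix parametrised by its diagonal elements, and consider the model $$p_\theta(z)=\mathcal N(0,I),\qquad p_\theta(x|z)=\mathcal N(\mathrm{NN}_w(z),\Sigma),\qquad z\in\mathbb{R}^m,\ x\in\mathbb{R}^d .$$ Fix a parameter value $\theta=(w,\Sigma)$ and assume: 1. every nonlinearity $\sigma_\ell$ is Lipschitz, and for Lebesgue-almost every $z$ the map $w'\mapsto\mathrm{NN}_{w'}(z)$ is differentiable at $w$; 2. $\mathbb{E}_{p_\theta(z)}\|\mathrm{NN}_w(z)\|_2^2<\infty$; 3. the spectral norm of the weight matrix of every layer at $w$ is at most a positive constant $B$; 4. the diagonal elements of $\Sigma$ are at least a positive constant $c$. Then for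 every $x$ the gradient $\nabla_\theta\log p_\theta(z,x)$ is integrable under the posterior $p_\theta(z|x)$, and the regression target $$y(x)=\mathbb{E}_{p_\theta(z|x)}\bigl[\nabla_\theta\log p_\theta(z,x)\bigr]$$ is square-integrable under the marginal $p_\theta(x)$. Consequently $y$ can be approximated arbitrarily well by kernel ridge regression with sufficiently many samples from the model. Let $\mathcal H$ be a reproducing kernel Hilbert space of functions from $\mathbb{R}^d$ to the parameter space $\mathbb{R}^{p+d}$ (for example with kernel $k(x,x')I$ for a scalar kernel $k$) that is $C_0$-universal: its elements are continuous and vanish at infinity, and they are uniformly dense in $C_0(\mathbb{R}^d,\mathbb{R}^{p+d})$. Let $\lambda_N>0$ with $\lambda_N\to0$ and $N\lambda_N^2\to\infty$. For each $N$ and all $(z_n,x_n)_{n\le N}$, the regularised empirical risk $$f\mapsto\frac1N\sum_{n=1}^N\bigl\|\nabla_\theta\log p_\theta(z_n,x_n)-f(x_n)\bigr\|_2^2+\lambda_N\|f\|_{\mathcal H}^2$$ (for $N=0$ the first term is $0$) has a unique minimiser $\hat f_N$ over $\mathcal H$, and if $(z_n,x_n)_{n\le N}$ are i.i.d. from $p_\theta(z,x)$,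 then $$\mathbb{E}\Bigl[\mathbb{E}_{p_\theta(x)}\bigl\|\hat f_N(x)-y(x)\bigr\|_2^2\Bigr]\longrightarrow0\qquad(N\to\infty),$$ where the outer expectation is over the samples. -/

import Mathlib

open MeasureTheory ProbabilityTheory Filter Topology
open scoped ENNReal NNReal ZeroAtInfty

noncomputable section

/-- `ℝⁿ` with the Euclidean norm. -/
abbrev Vec (n : ℕ) : Type := EuclideanSpace ℝ (Fin n)

/-- Feed-forward neural networks with parameter vector in `ℝᵖ`, input in `ℝᵐ` and output in `ℝⁿ`.
A layer sends the previous output `h` to `σ (W(w) h + b(w))`. The weight matrix `W(w)`, regarded as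
a linear operator between Euclidean spaces, and the bias `b(w)` depend linearly on the parameter
vector `w`: a dense layer reads its entries off `w`, a convolutional layer shares entries, a layer
without bias has `b = 0`. The nonlinearity `σ` is a map between Euclidean spaces (coordinatewise
activations, pooling, or the identity for a linear output layer). -/
inductive NeuralNetwork (p m : ℕ) : ℕ → Type
  | input : NeuralNetwork p m m
  | layer {n k l : ℕ} (prev : NeuralNetwork p m n)
      (W : Vec p →L[ℝ] (Vec n →L[ℝ] Vec k)) (b : Vec p →L[ℝ] Vec k)
      (σ : Vec k → Vec l) : NeuralNetwork p m l

namespace NeuralNetwork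

/-- The function `NN_w(z)`. -/
def eval {p m : ℕ} : {n : ℕ} → NeuralNetwork p m n → Vec p → Vec m → Vec n
  | _, input, _, z => z
  | _, layer prev W b σ, w, z => σ (W w (prev.eval w z) + b w)

/-- Every nonlinearity of the network is Lipschitz. -/
def LipschitzNonlinearities {p m : ℕ} : {n : ℕ} → NeuralNetwork p m n → Prop
  | _, input => True
  | _, layer prev _ _ σ => prev.LipschitzNonlinearities ∧ ∃ K : ℝ≥0, LipschitzWith K σ

/-- The spectral norm of the weight matrix of every layer, at the parameter `w`, is at most `B`.
The norm on `Vec n →L[ℝ] Vec k` is the Euclidean operator norm, that is, the spectral norm. -/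
def SpectralNormLE {p m : ℕ} (w : Vec p) (B : ℝ) : {n : ℕ} → NeuralNetwork p m n → Prop
  | _, input => True
  | _, layer prev W _ _ => SpectralNormLE w B prev ∧ ‖W w‖ ≤ B

end NeuralNetwork

/-- The parameter space of `θ = (w, Σ)`: `p` network parameters and the `d` diagonal elements of
the diagonal covariance matrix `Σ`, with the Euclidean norm. -/
abbrev Param (p d : ℕ) : Type := EuclideanSpace ℝ (Fin p ⊕ Fin d)

namespace Param

/-- The network parameters `w` of `θ = (w, Σ)`. -/
def weights {p d : ℕ} (θ : Param p d) : Vec p := WithLp.toLp 2 fun i => θ (Sum.inl i)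

/-- The `i`-th diagonal element of `Σ`, for `θ = (w, Σ)`. -/
def variance {p d : ℕ} (θ : Param p d) (i : Fin d) : ℝ := θ (Sum.inr i)

end Param

/-- The measure on a Euclidean space (or a product of two) with Lebesgue density `f`. -/
def lawOfDensity {α : Type*} [MeasureSpace α] (f : α → ℝ) : Measure α :=
  volume.withDensity fun a => ENNReal.ofReal (f a)

/-- The density `p(z)` of the standard Gaussian prior on `ℝᵐ`. -/
def priorDensity {m : ℕ} (z : Vec m) : ℝ := ∏ i, gaussianPDFReal 0 1 (z i)

/-- The standard Gaussian prior on `ℝᵐ`. -/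
def priorLaw (m : ℕ) : Measure (Vec m) := lawOfDensity priorDensity

section Model

variable {p m d : ℕ}

/-- The density `p_θ(x|z)` of the Gaussian with mean `NN_w(z)` and diagonal covariance `Σ`
(meaningful when the diagonal elements of `Σ` are positive). -/
def likelihoodDensity (NN : NeuralNetwork p m d) (θ : Param p d) (z : Vec m) (x : Vec d) : ℝ :=
  ∏ i, gaussianPDFReal (NN.eval θ.weights z i) (θ.variance i).toNNReal (x i)

/-- The joint density `p_θ(z,x) = p(z) p_θ(x|z)`. -/
def jointDensity (NN : NeuralNetwork p m d) (θ : Param p d) (z : Vec m) (x : Vec d) : ℝ :=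
  priorDensity z * likelihoodDensity NN θ z x

/-- The marginal density `p_θ(x) = ∫ p_θ(z,x) dz`. -/
def marginalDensity (NN : NeuralNetwork p m d) (θ : Param p d) (x : Vec d) : ℝ :=
  ∫ z, jointDensity NN θ z x

/-- The posterior density `p_θ(z|x) = p_θ(z,x) / p_θ(x)`. -/
def posteriorDensity (NN : NeuralNetwork p m d) (θ : Param p d) (x : Vec d) (z : Vec m) : ℝ :=
  jointDensity NN θ z x / marginalDensity NN θ x

/-- The law of `(z,x)` under the model. -/
def jointLaw (NN : NeuralNetwork p m d) (θ : Param p d) : Measure (Vec m × Vec d) :=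
  lawOfDensity fun s => jointDensity NN θ s.1 s.2

/-- The marginal law `p_θ(x)`. -/
def marginalLaw (NN : NeuralNetwork p m d) (θ : Param p d) : Measure (Vec d) :=
  lawOfDensity (marginalDensity NN θ)

/-- The posterior law `p_θ(z|x)`. -/
def posteriorLaw (NN : NeuralNetwork p m d) (θ : Param p d) (x : Vec d) : Measure (Vec m) :=
  lawOfDensity (posteriorDensity NN θ x)

/-- The gradient `∇_θ log p_θ(z,x)` with respect to all the parameters `θ = (w, Σ)`. -/
def scoreGradient (NN : NeuralNetwork p m d) (θ : Param p d) (z : Vec m) (x : Vec d) :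
    Param p d :=
  gradient (fun θ' => Real.log (jointDensity NN θ' z x)) θ

/-- The regression target `E_{p_θ(z|x)} [∇_θ log p_θ(z,x)]`. -/
def gradientTarget (NN : NeuralNetwork p m d) (θ : Param p d) (x : Vec d) : Param p d :=
  ∫ z, scoreGradient NN θ z x ∂(posteriorLaw NN θ x)

end Model

section KernelRidgeRegression

variable {X V H : Type*} [NormedAddCommGroup V] [InnerProductSpace ℝ V]
  [NormedAddCommGroup H] [InnerProductSpace ℝ H] [RKHS ℝ H X V]

variable (H) in
/-- `C₀`-universality of the (operator-valued) kernel of `H`: the functions in `H` are continuous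
and vanish at infinity, and they are dense in `C₀(X, V)` for the uniform norm. -/
def IsC0Universal [TopologicalSpace X] : Prop :=
  (∀ f : H, Continuous (f : X → V) ∧ Tendsto (f : X → V) (cocompact X) (𝓝 0)) ∧
  ∀ g : C₀(X, V), ∀ ε > 0, ∃ f : H, ∀ x, ‖f x - g x‖ ≤ ε

/-- The regularised empirical risk `(1/N) ∑ₙ ‖yₙ - f(xₙ)‖² + lam ‖f‖²`. -/
def krrObjective {N : ℕ} (lam : ℝ) (x : Fin N → X) (y : Fin N → V) (f : H) : ℝ :=
  (1 / (N : ℝ)) * ∑ n, ‖y n - f (x n)‖ ^ 2 + lam * ‖f‖ ^ 2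

/-- `f` is the kernel ridge regression estimator: it minimises the regularised empirical risk
over `H`. -/
def IsKRREstimator {N : ℕ} (lam : ℝ) (x : Fin N → X) (y : Fin N → V) (f : H) : Prop :=
  IsMinOn (krrObjective lam x y) Set.univ f

end KernelRidgeRegression

end

/-! The score. Near a parameter with positive variances, `log p_θ(z,x)` is an explicit function of
the residual `e = x - NN_w(z)`. Its derivative in `Σ` is quadratic in `e`; its derivative in `w` is
linear in `e` times the Jacobian of the network in `w`. Lipschitz layers, affine in `h` with
coefficients linear in `w`, make this Jacobian grow at most linearly in `z`, so the score is at most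
`C (1 + ‖z‖² + ‖e‖²)` (`exists_norm_scoreFormula_le`). Under the model `z` and `e` are independent
centred Gaussians, so their fourth moments give a square-integrable score (`memLp_scoreFormula`),
and Jensen's inequality under the posterior gives a square-integrable target. By disintegration the
target is the conditional expectation of the score given `x` (`integral_inner_scoreFormula`).

The regression. Let `f₀` minimise the population ridge risk at level `lam`. Then `‖fhat - y‖²` is at
most twice an estimation error plus twice an approximation error. The approximation error `‖y -
f₀‖²` in `L²` tends to `0` because `H` is dense in `L²` and `lam → 0`. For the estimation error,
strong convexity of the empirical risk gives `lam ‖fhat - f₀‖ ≤ ‖average of ζ‖` with `ζ = K_x (Y -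
f₀(x)) - lam f₀` (`norm_sub_le_of_krr_normalEquation`). The population normal equation says that `ζ`
is centred, so by independence the squared average has expectation `E‖ζ‖² / N`
(`integral_norm_average_sq`). As `E‖ζ‖²` stays bounded while `lam → 0`, the estimation error is `O(1
/ (N lam²))`. -/

/-! ### Centred Gaussian densities with diagonal covariance -/

/-- The density of the centred Gaussian on `ℝⁿ` with diagonal covariance `v`. -/
noncomputable def diagGaussianDensity {n : ℕ} (v : Fin n → ℝ≥0) (e : Vec n) : ℝ :=
  ∏ i, gaussianPDFReal 0 (v i) (e i)

lemma integrable_pow_mul_gaussianPDFReal (k : ℕ) {v : ℝ≥0} (hv : v ≠ 0) :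
    Integrable (fun t : ℝ => t ^ k * gaussianPDFReal 0 v t) := by
  have h : Integrable (fun t : ℝ => t ^ k) (gaussianReal 0 v) := by
    have h1 : MemLp (id : ℝ → ℝ) (k : ℝ≥0∞) (gaussianReal 0 v) :=
      memLp_id_gaussianReal' _ (by simp)
    have h2 := h1.integrable_norm_pow'
    refine h2.mono (by fun_prop) (ae_of_all _ fun t => by simp)
  rw [gaussianReal_of_var_ne_zero _ hv,
    integrable_withDensity_iff_integrable_smul' (measurable_gaussianPDF 0 v)
      (ae_of_all _ fun t => gaussianPDF_lt_top)] at h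
  refine h.congr (ae_of_all _ fun t => ?_)
  simp [toReal_gaussianPDF, mul_comm]

section DiagGaussian

variable {n : ℕ} {v : Fin n → ℝ≥0}

lemma diagGaussianDensity_nonneg (v : Fin n → ℝ≥0) (e : Vec n) : 0 ≤ diagGaussianDensity v e :=
  Finset.prod_nonneg fun _ _ => gaussianPDFReal_nonneg _ _ _

lemma diagGaussianDensity_pos (hv : ∀ i, v i ≠ 0) (e : Vec n) : 0 < diagGaussianDensity v e :=
  Finset.prod_pos fun i _ => gaussianPDFReal_pos _ _ _ (hv i)

lemma continuous_diagGaussianDensity (v : Fin n → ℝ≥0) : Continuous (diagGaussianDensity v) := by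
  unfold diagGaussianDensity gaussianPDFReal
  fun_prop

lemma gaussianPDFReal_le (v : ℝ≥0) (t : ℝ) :
    gaussianPDFReal 0 v t ≤ (√(2 * Real.pi * v))⁻¹ := by
  unfold gaussianPDFReal
  refine mul_le_of_le_one_right (by positivity) (Real.exp_le_one_iff.2 ?_)
  have : 0 ≤ (t - 0) ^ 2 / (2 * v) := by positivity
  rw [neg_div]; linarith

lemma diagGaussianDensity_le (v : Fin n → ℝ≥0) (e : Vec n) :
    diagGaussianDensity v e ≤ ∏ i, (√(2 * Real.pi * v i))⁻¹ :=
  Finset.prod_le_prod (fun _ _ => gaussianPDFReal_nonneg _ _ _) fun _ _ => gaussianPDFReal_le _ _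

lemma integrable_diagGaussianDensity (v : Fin n → ℝ≥0) : Integrable (diagGaussianDensity v) := by
  rw [← (PiLp.volume_preserving_toLp (Fin n)).integrable_comp_emb
    (MeasurableEquiv.toLp 2 _).measurableEmbedding]
  exact Integrable.fintype_prod fun i => integrable_gaussianPDFReal 0 (v i)

lemma integral_diagGaussianDensity (hv : ∀ i, v i ≠ 0) : ∫ e, diagGaussianDensity v e = 1 := by
  rw [← (PiLp.volume_preserving_toLp (Fin n)).integral_comp
    (MeasurableEquiv.toLp 2 _).measurableEmbedding]
  simp only [diagGaussianDensity]
  rw [integral_fintype_prod_volume_eq_prod (fun i t => gaussianPDFReal 0 (v i) t)]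
  exact Finset.prod_eq_one fun i _ => integral_gaussianPDFReal_eq_one 0 (hv i)

lemma integrable_coord_pow_mul_diagGaussianDensity (hv : ∀ i, v i ≠ 0) (k : ℕ) (i : Fin n) :
    Integrable (fun e : Vec n => e i ^ k * diagGaussianDensity v e) := by
  rw [← (PiLp.volume_preserving_toLp (Fin n)).integrable_comp_emb
    (MeasurableEquiv.toLp 2 _).measurableEmbedding]
  have h : Integrable (fun x : Fin n → ℝ =>
      ∏ j, ((if j = i then x j ^ k else 1) * gaussianPDFReal 0 (v j) (x j))) := by
    refine Integrable.fintype_prod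
      (f := fun j t => (if j = i then t ^ k else 1) * gaussianPDFReal 0 (v j) t) fun j => ?_
    by_cases hj : j = i
    · simpa [hj] using integrable_pow_mul_gaussianPDFReal k (hv i)
    · simpa [hj] using integrable_gaussianPDFReal 0 (v j)
  refine h.congr (ae_of_all _ fun x => ?_)
  beta_reduce
  rw [Finset.prod_mul_distrib, Finset.prod_ite_eq' Finset.univ i fun j => x j ^ k]
  simp [diagGaussianDensity]

/-- Cauchy–Schwarz: `(∑ eᵢ²)² ≤ n ∑ eᵢ⁴`. The fourth power is what squaring a quadratically growing
score requires. -/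
lemma integrable_norm_pow_four_mul_diagGaussianDensity (hv : ∀ i, v i ≠ 0) :
    Integrable (fun e : Vec n => ‖e‖ ^ 4 * diagGaussianDensity v e) := by
  have h := (integrable_finsetSum Finset.univ fun i _ =>
    integrable_coord_pow_mul_diagGaussianDensity hv 4 i).const_mul (n : ℝ)
  refine h.mono' ((by fun_prop : Continuous fun e : Vec n => ‖e‖ ^ 4).mul
    (continuous_diagGaussianDensity v)).aestronglyMeasurable (ae_of_all _ fun e => ?_)
  rw [Real.norm_of_nonneg (mul_nonneg (by positivity) (diagGaussianDensity_nonneg v e)),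
    ← Finset.sum_mul, ← mul_assoc]
  refine mul_le_mul_of_nonneg_right ?_ (diagGaussianDensity_nonneg v e)
  have h2 := sq_sum_le_card_mul_sum_sq (s := Finset.univ) (f := fun i => e i ^ 2)
  simp only [Finset.card_univ, Fintype.card_fin, ← pow_mul] at h2
  calc ‖e‖ ^ 4 = (‖e‖ ^ 2) ^ 2 := by ring
    _ = (∑ i, e i ^ 2) ^ 2 := by rw [EuclideanSpace.real_norm_sq_eq]
    _ ≤ _ := h2

end DiagGaussian

/-! ### Regularity of neural networks -/

namespace NeuralNetwork

variable {p m : ℕ}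

lemma LipschitzNonlinearities.continuous_eval : ∀ {n : ℕ} {NN : NeuralNetwork p m n},
    NN.LipschitzNonlinearities → Continuous fun a : Vec p × Vec m => NN.eval a.1 a.2
  | _, input, _ => continuous_snd
  | _, layer prev W b σ, hNN => by
    obtain ⟨hprev, K, hK⟩ : prev.LipschitzNonlinearities ∧ ∃ K : ℝ≥0, LipschitzWith K σ := hNN
    have h := hprev.continuous_eval
    simp only [eval]
    exact hK.continuous.comp
      (((W.continuous.comp continuous_fst).clm_apply h).add (b.continuous.comp continuous_fst))

lemma LipschitzNonlinearities.exists_norm_eval_le : ∀ {n : ℕ} {NN : NeuralNetwork p m n},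
    NN.LipschitzNonlinearities → ∀ R : ℝ, ∃ C, 0 ≤ C ∧
      ∀ w : Vec p, ‖w‖ ≤ R → ∀ z, ‖NN.eval w z‖ ≤ C * (1 + ‖z‖)
  | _, input, _, R => ⟨1, zero_le_one, fun w _ z => by simp [eval]⟩
  | _, layer prev W b σ, hNN, R => by
    obtain ⟨hprev, K, hK⟩ : prev.LipschitzNonlinearities ∧ ∃ K : ℝ≥0, LipschitzWith K σ := hNN
    obtain ⟨C, hC, h⟩ := hprev.exists_norm_eval_le R
    -- `|R|` keeps the constant nonnegative when `R < 0`, where the bound on `w` is vacuous.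
    refine ⟨K * (‖W‖ * |R| * C + ‖b‖ * |R|) + ‖σ 0‖, by positivity, fun w hw z => ?_⟩
    have hw' : ‖w‖ ≤ |R| := hw.trans (le_abs_self R)
    have hz : (0 : ℝ) ≤ ‖z‖ := norm_nonneg z
    set u := W w (prev.eval w z) + b w with hu
    have h1 : ‖u‖ ≤ (‖W‖ * |R| * C + ‖b‖ * |R|) * (1 + ‖z‖) := by
      calc ‖u‖ ≤ ‖W w (prev.eval w z)‖ + ‖b w‖ := norm_add_le _ _
        _ ≤ ‖W‖ * ‖w‖ * ‖prev.eval w z‖ + ‖b‖ * ‖w‖ := by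
          gcongr
          · exact W.le_opNorm₂ _ _
          · exact b.le_opNorm _
        _ ≤ ‖W‖ * |R| * (C * (1 + ‖z‖)) + ‖b‖ * |R| * (1 + ‖z‖) := by
          refine add_le_add (by gcongr; exact h w hw z) ?_
          calc ‖b‖ * ‖w‖ ≤ ‖b‖ * |R| := by gcongr
            _ ≤ _ := le_mul_of_one_le_right (by positivity) (by linarith)
        _ = _ := by ring
    have h2 : ‖σ u‖ ≤ K * ‖u‖ + ‖σ 0‖ := by
      have := hK.dist_le_mul u 0
      rw [dist_eq_norm, dist_zero_right] at this
      linarith [norm_sub_norm_le (σ u) (σ 0)]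
    calc ‖σ u‖ ≤ K * ‖u‖ + ‖σ 0‖ * 1 := by rw [mul_one]; exact h2
      _ ≤ K * ((‖W‖ * |R| * C + ‖b‖ * |R|) * (1 + ‖z‖)) + ‖σ 0‖ * (1 + ‖z‖) := by
        gcongr; linarith
      _ = _ := by ring

/-- Induction on the layers. Since `W(w) h` is bilinear in `(w, h)`, its increment splits into a
change of `h` at fixed weights, controlled by induction, and a change of weights at fixed `h`, which
costs the linear growth of `h` in `z`. -/
lemma LipschitzNonlinearities.exists_norm_eval_sub_le : ∀ {n : ℕ} {NN : NeuralNetwork p m n},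
    NN.LipschitzNonlinearities → ∀ R : ℝ, ∃ C, 0 ≤ C ∧
      ∀ w w' : Vec p, ‖w‖ ≤ R → ‖w'‖ ≤ R → ∀ z,
        ‖NN.eval w' z - NN.eval w z‖ ≤ C * (1 + ‖z‖) * ‖w' - w‖
  | _, input, _, R => ⟨0, le_rfl, fun w w' _ _ z => by simp [eval]⟩
  | _, layer prev W b σ, hNN, R => by
    obtain ⟨hprev, K, hK⟩ : prev.LipschitzNonlinearities ∧ ∃ K : ℝ≥0, LipschitzWith K σ := hNN
    obtain ⟨C, hC, h⟩ := hprev.exists_norm_eval_sub_le R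
    obtain ⟨C₁, hC₁, h₁⟩ := hprev.exists_norm_eval_le R
    refine ⟨K * (‖W‖ * |R| * C + ‖W‖ * C₁ + ‖b‖), by positivity, fun w w' hw hw' z => ?_⟩
    have hwR : ‖w'‖ ≤ |R| := hw'.trans (le_abs_self R)
    have hz : (0 : ℝ) ≤ ‖z‖ := norm_nonneg z
    simp only [eval]
    have h2 := hK.dist_le_mul (W w' (prev.eval w' z) + b w') (W w (prev.eval w z) + b w)
    rw [dist_eq_norm, dist_eq_norm] at h2
    refine h2.trans ?_
    rw [mul_assoc (K : ℝ), mul_assoc (K : ℝ)]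
    refine mul_le_mul_of_nonneg_left ?_ K.2
    have e : W w' (prev.eval w' z) + b w' - (W w (prev.eval w z) + b w)
        = W w' (prev.eval w' z - prev.eval w z) + W (w' - w) (prev.eval w z) + b (w' - w) := by
      simp only [map_sub, sub_apply]; abel
    rw [e]
    calc _ ≤ ‖W w' (prev.eval w' z - prev.eval w z)‖ + ‖W (w' - w) (prev.eval w z)‖
          + ‖b (w' - w)‖ := norm_add₃_le
      _ ≤ ‖W‖ * ‖w'‖ * ‖prev.eval w' z - prev.eval w z‖
          + ‖W‖ * ‖w' - w‖ * ‖prev.eval w z‖ + ‖b‖ * ‖w' - w‖ := by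
        gcongr
        · exact W.le_opNorm₂ _ _
        · exact W.le_opNorm₂ _ _
        · exact b.le_opNorm _
      _ ≤ ‖W‖ * |R| * (C * (1 + ‖z‖) * ‖w' - w‖)
          + ‖W‖ * ‖w' - w‖ * (C₁ * (1 + ‖z‖)) + ‖b‖ * (1 + ‖z‖) * ‖w' - w‖ := by
        gcongr
        · exact h w w' hw hw' z
        · exact h₁ w hw z
        · exact le_mul_of_one_le_right (norm_nonneg b) (by linarith)
      _ = _ := by ring

/-- A local Lipschitz constant bounds the derivative. No differentiability is needed: elsewhere
`fderiv` is `0`. -/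
lemma LipschitzNonlinearities.exists_norm_fderiv_eval_le {n : ℕ} {NN : NeuralNetwork p m n}
    (hNN : NN.LipschitzNonlinearities) (w : Vec p) :
    ∃ C, 0 ≤ C ∧ ∀ z, ‖fderiv ℝ (fun w => NN.eval w z) w‖ ≤ C * (1 + ‖z‖) := by
  -- The ball of radius `‖w‖ + 1` about the origin contains the unit ball about `w`.
  obtain ⟨C, hC, h⟩ := hNN.exists_norm_eval_sub_le (‖w‖ + 1)
  refine ⟨C, hC, fun z => norm_fderiv_le_of_lip' ℝ (by positivity) ?_⟩
  filter_upwards [Metric.closedBall_mem_nhds w one_pos] with w' hw'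
  refine h w w' (by linarith) ?_ z
  rw [mem_closedBall_iff_norm] at hw'
  linarith [norm_le_norm_add_norm_sub' w' w]

lemma LipschitzNonlinearities.measurable_fderiv_eval {n : ℕ} {NN : NeuralNetwork p m n}
    (hNN : NN.LipschitzNonlinearities) (w : Vec p) :
    Measurable fun z : Vec m => fderiv ℝ (fun w => NN.eval w z) w := by
  have h : Continuous (Function.uncurry fun (z : Vec m) (w : Vec p) => NN.eval w z) :=
    hNN.continuous_eval.comp continuous_swap
  exact (measurable_fderiv_with_param ℝ h).comp (measurable_id.prodMk measurable_const)

end NeuralNetwork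

/-! ### The score of the model -/

namespace Param

variable {p d : ℕ}

/-- The projection of `θ = (w, Σ)` to `w`, as a continuous linear map. -/
noncomputable def weightsCLM (p d : ℕ) : Param p d →L[ℝ] Vec p :=
  ((PiLp.continuousLinearEquiv 2 ℝ fun _ : Fin p => ℝ).symm : (Fin p → ℝ) →L[ℝ] Vec p) ∘L
    ContinuousLinearMap.pi fun i => EuclideanSpace.proj (Sum.inl i)

@[simp]
lemma weightsCLM_apply (θ : Param p d) : weightsCLM p d θ = θ.weights := rfl

/-- The `i`-th diagonal element of `Σ`, as a continuous linear functional of `θ = (w, Σ)`. -/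
noncomputable def varianceCLM (p : ℕ) {d : ℕ} (i : Fin d) : Param p d →L[ℝ] ℝ :=
  EuclideanSpace.proj (Sum.inr i)

@[simp]
lemma varianceCLM_apply (θ : Param p d) (i : Fin d) : varianceCLM p i θ = θ.variance i := rfl

end Param

lemma gaussianPDFReal_eq_centred (μ : ℝ) (v : ℝ≥0) (x : ℝ) :
    gaussianPDFReal μ v x = gaussianPDFReal 0 v (x - μ) := by
  rw [gaussianPDFReal_sub, zero_add]

lemma log_gaussianPDFReal (μ x : ℝ) {v : ℝ} (hv : 0 < v) :
    Real.log (gaussianPDFReal μ v.toNNReal x)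
      = -(1 / 2) * Real.log (2 * Real.pi * v) - (x - μ) ^ 2 / (2 * v) := by
  have h : 0 < 2 * Real.pi * v := by positivity
  rw [gaussianPDFReal, Real.coe_toNNReal _ hv.le, Real.log_mul (by positivity) (by positivity),
    Real.log_inv, Real.log_sqrt h.le, Real.log_exp]
  ring

section Score

variable {p m d : ℕ}

lemma priorDensity_eq (z : Vec m) : priorDensity z = diagGaussianDensity 1 z := rfl

lemma priorDensity_pos (z : Vec m) : 0 < priorDensity z :=
  diagGaussianDensity_pos (fun _ => one_ne_zero) z

lemma likelihoodDensity_eq (NN : NeuralNetwork p m d) (θ : Param p d) (z : Vec m) (x : Vec d) :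
    likelihoodDensity NN θ z x
      = diagGaussianDensity (fun i => (θ.variance i).toNNReal) (x - NN.eval θ.weights z) :=
  Finset.prod_congr rfl fun _ _ => gaussianPDFReal_eq_centred _ _ _

lemma log_jointDensity (NN : NeuralNetwork p m d) (θ : Param p d) (z : Vec m) (x : Vec d)
    (hθ : ∀ i, 0 < θ.variance i) :
    Real.log (jointDensity NN θ z x) = Real.log (priorDensity z) +
      ∑ i, (-(1 / 2) * Real.log (2 * Real.pi * θ.variance i)
        - (x i - NN.eval θ.weights z i) ^ 2 / (2 * θ.variance i)) := by
  have h : ∀ i ∈ Finset.univ, gaussianPDFReal (NN.eval θ.weights z i) (θ.variance i).toNNReal (x i)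
      ≠ 0 := fun i _ => (gaussianPDFReal_pos _ _ _ (by simpa using hθ i)).ne'
  rw [jointDensity, likelihoodDensity, Real.log_mul (priorDensity_pos z).ne'
    (Finset.prod_ne_zero_iff.2 h), Real.log_prod h]
  simp only [log_gaussianPDFReal _ _ (hθ _)]

/-- The differential of `log p_θ(z,x)` in `θ`. -/
noncomputable def scoreDifferential (NN : NeuralNetwork p m d) (θ : Param p d) (z : Vec m)
    (x : Vec d) : Param p d →L[ℝ] ℝ :=
  ∑ i, ((-(1 / 2) * (θ.variance i)⁻¹
      + (x i - NN.eval θ.weights z i) ^ 2 / (2 * θ.variance i ^ 2)) • Param.varianceCLM p i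
    + ((x i - NN.eval θ.weights z i) / θ.variance i) •
      ((EuclideanSpace.proj i : Vec d →L[ℝ] ℝ) ∘L
        fderiv ℝ (fun w => NN.eval w z) θ.weights ∘L Param.weightsCLM p d))

/-- The gradient of `log p_θ(z,x)` in `θ`, as an explicit formula. -/
noncomputable def scoreFormula (NN : NeuralNetwork p m d) (θ : Param p d) (z : Vec m)
    (x : Vec d) : Param p d :=
  (InnerProductSpace.toDual ℝ (Param p d)).symm (scoreDifferential NN θ z x)

lemma hasFDerivAt_log_jointDensity {NN : NeuralNetwork p m d} {θ : Param p d} {z : Vec m}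
    (hNN : DifferentiableAt ℝ (fun w => NN.eval w z) θ.weights) (hθ : ∀ i, 0 < θ.variance i)
    (x : Vec d) :
    HasFDerivAt (fun θ' => Real.log (jointDensity NN θ' z x)) (scoreDifferential NN θ z x) θ := by
  -- Positivity of the variances is an open condition, so the closed form of the log-density holds
  -- near `θ` and may be differentiated.
  have hev : ∀ᶠ θ' : Param p d in 𝓝 θ, ∀ i, 0 < θ'.variance i :=
    eventually_all.2 fun i =>
      (Param.varianceCLM p i).continuous.continuousAt.eventually (lt_mem_nhds (hθ i))
  have hform : (fun θ' : Param p d => Real.log (jointDensity NN θ' z x)) =ᶠ[𝓝 θ] fun θ' =>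
      Real.log (priorDensity z) + ∑ i, (-(1 / 2) * Real.log (2 * Real.pi * θ'.variance i)
        - (x i - NN.eval θ'.weights z i) ^ 2 / (2 * θ'.variance i)) :=
    hev.mono fun θ' h => log_jointDensity NN θ' z x h
  refine HasFDerivAt.congr_of_eventuallyEq ?_ hform
  refine HasFDerivAt.const_add _ (HasFDerivAt.fun_sum fun i _ => ?_)
  have hv : HasFDerivAt (fun θ' : Param p d => θ'.variance i) (Param.varianceCLM p i) θ :=
    (Param.varianceCLM p i).hasFDerivAt
  have hw : HasFDerivAt (fun θ' : Param p d => NN.eval θ'.weights z)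
      (fderiv ℝ (fun w => NN.eval w z) θ.weights ∘L Param.weightsCLM p d) θ :=
    HasFDerivAt.comp θ (f := Param.weightsCLM p d) (g := fun w => NN.eval w z) hNN.hasFDerivAt
      (Param.weightsCLM p d).hasFDerivAt
  have hi : HasFDerivAt (fun θ' : Param p d => NN.eval θ'.weights z i)
      ((EuclideanSpace.proj i : Vec d →L[ℝ] ℝ) ∘L
        fderiv ℝ (fun w => NN.eval w z) θ.weights ∘L Param.weightsCLM p d) θ :=
    (EuclideanSpace.proj i : Vec d →L[ℝ] ℝ).hasFDerivAt.comp θ hw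
  have hpos := hθ i
  have h1 := ((hv.const_mul (2 * Real.pi)).log (by positivity)).const_mul (-(1 / 2) : ℝ)
  have h2 := ((hi.const_sub (x i)).pow 2).mul
    ((hasDerivAt_inv (x := 2 * θ.variance i) (by positivity)).comp_hasFDerivAt θ (hv.const_mul 2))
  refine (h1.sub h2).congr_fderiv ?_
  ext u
  simp
  field_simp
  ring

/-- The two sides may differ on the null set of `z` where the network is not differentiable in `w`.
The formula is measurable and bounded without exception, so the analysis is done for it and
transferred almost everywhere. -/
lemma scoreGradient_eq_scoreFormula {NN : NeuralNetwork p m d} {θ : Param p d} {z : Vec m}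
    (hNN : DifferentiableAt ℝ (fun w => NN.eval w z) θ.weights) (hθ : ∀ i, 0 < θ.variance i)
    (x : Vec d) : scoreGradient NN θ z x = scoreFormula NN θ z x := by
  rw [scoreGradient, gradient, (hasFDerivAt_log_jointDensity hNN hθ x).fderiv, scoreFormula]

lemma measurable_scoreFormula {NN : NeuralNetwork p m d} (hNN : NN.LipschitzNonlinearities)
    (θ : Param p d) : Measurable fun s : Vec m × Vec d => scoreFormula NN θ s.1 s.2 := by
  have hF : Measurable fun s : Vec m × Vec d =>
      fderiv ℝ (fun w => NN.eval w s.1) θ.weights :=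
    (hNN.measurable_fderiv_eval θ.weights).comp measurable_fst
  have he : Continuous fun s : Vec m × Vec d => NN.eval θ.weights s.1 :=
    hNN.continuous_eval.comp (continuous_const.prodMk continuous_fst)
  have hr : ∀ i, Measurable fun s : Vec m × Vec d => s.2 i - NN.eval θ.weights s.1 i := fun i =>
    (by fun_prop : Continuous fun s : Vec m × Vec d => s.2 i - NN.eval θ.weights s.1 i).measurable
  refine (InnerProductSpace.toDual ℝ (Param p d)).symm.continuous.measurable.comp ?_
  unfold scoreDifferential
  refine Finset.measurable_fun_sum _ fun i _ => Measurable.add ?_ ?_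
  · exact (((hr i).pow_const 2).div_const _ |>.const_add _).smul_const _
  · refine ((hr i).div_const _).smul ?_
    have hc : Continuous fun T : Vec p →L[ℝ] Vec d =>
        (EuclideanSpace.proj i : Vec d →L[ℝ] ℝ) ∘L T ∘L Param.weightsCLM p d := by fun_prop
    exact hc.measurable.comp hF

/-- The `Σ`-part is quadratic in the residual `e`. The `w`-part is of order `‖e‖ (1 + ‖z‖)`, which
is at most `2 (1 + ‖z‖² + ‖e‖²)` by the inequality between arithmetic and geometric means. -/
lemma exists_norm_scoreFormula_le {NN : NeuralNetwork p m d} (hNN : NN.LipschitzNonlinearities)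
    (θ : Param p d) : ∃ C, 0 ≤ C ∧ ∀ z x,
      ‖scoreFormula NN θ z x‖ ≤ C * (1 + ‖z‖ ^ 2 + ‖x - NN.eval θ.weights z‖ ^ 2) := by
  obtain ⟨C, hC, h⟩ := hNN.exists_norm_fderiv_eval_le θ.weights
  refine ⟨∑ i, ((1 / 2 * |θ.variance i|⁻¹ + 1 / (2 * θ.variance i ^ 2)) * ‖Param.varianceCLM p i‖
    + 2 / |θ.variance i| * (‖(EuclideanSpace.proj i : Vec d →L[ℝ] ℝ)‖ * (C *
      ‖Param.weightsCLM p d‖))), Finset.sum_nonneg fun i _ => by positivity, fun z x => ?_⟩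
  rw [scoreFormula, LinearIsometryEquiv.norm_map, scoreDifferential, Finset.sum_mul]
  refine norm_sum_le_of_le _ fun i _ => ?_
  set e := x - NN.eval θ.weights z with he
  have hei : x i - NN.eval θ.weights z i = e i := by simp [he]
  have hr : |e i| ≤ ‖e‖ := by simpa using PiLp.norm_apply_le e i
  rw [hei]
  have hz := norm_nonneg z
  have hr2 : e i ^ 2 ≤ 1 + ‖z‖ ^ 2 + ‖e‖ ^ 2 := by
    have := sq_le_sq' (abs_le.1 hr).1 (abs_le.1 hr).2
    nlinarith
  have hrz : |e i| * (1 + ‖z‖) ≤ 2 * (1 + ‖z‖ ^ 2 + ‖e‖ ^ 2) := by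
    have h1 : |e i| * (1 + ‖z‖) ≤ ‖e‖ * (1 + ‖z‖) := by gcongr
    nlinarith [sq_nonneg (‖e‖ - 1), sq_nonneg (‖e‖ - ‖z‖)]
  rw [add_mul]
  refine (norm_add_le _ _).trans (add_le_add ?_ ?_)
  · rw [norm_smul, mul_right_comm]
    refine mul_le_mul_of_nonneg_right ?_ (norm_nonneg _)
    refine (norm_add_le _ _).trans ?_
    simp only [norm_mul, norm_neg, norm_inv, norm_div, norm_pow, Real.norm_eq_abs, sq_abs, abs_one,
      abs_two, add_mul]
    refine add_le_add (le_mul_of_one_le_right (by positivity) (by nlinarith [sq_nonneg ‖e‖])) ?_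
    rw [div_eq_mul_one_div, mul_comm]
    gcongr
  · rw [norm_smul, norm_div, Real.norm_eq_abs, Real.norm_eq_abs]
    calc _ ≤ |e i| / |θ.variance i| * (‖(EuclideanSpace.proj i : Vec d →L[ℝ] ℝ)‖ *
          ((C * (1 + ‖z‖)) * ‖Param.weightsCLM p d‖)) := by
          gcongr
          refine (ContinuousLinearMap.opNorm_comp_le _ _).trans ?_
          gcongr
          refine (ContinuousLinearMap.opNorm_comp_le _ _).trans ?_
          gcongr
          exact h z
      _ = |e i| * (1 + ‖z‖) * (1 / |θ.variance i| * (‖(EuclideanSpace.proj i : Vec d →L[ℝ] ℝ)‖ *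
          (C * ‖Param.weightsCLM p d‖))) := by ring
      _ ≤ 2 * (1 + ‖z‖ ^ 2 + ‖e‖ ^ 2) * (1 / |θ.variance i| *
          (‖(EuclideanSpace.proj i : Vec d →L[ℝ] ℝ)‖ * (C * ‖Param.weightsCLM p d‖))) := by gcongr
      _ = _ := by ring

end Score

/-! ### The laws of the model -/

section LawOfDensity

variable {α E : Type*} [MeasureSpace α] [NormedAddCommGroup E] [NormedSpace ℝ E] {f : α → ℝ}

lemma integrable_lawOfDensity_iff (hf : Measurable f) (hf0 : ∀ a, 0 ≤ f a) {g : α → E} :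
    Integrable g (lawOfDensity f) ↔ Integrable fun a => f a • g a := by
  rw [lawOfDensity, integrable_withDensity_iff_integrable_smul' hf.ennreal_ofReal
    (ae_of_all _ fun _ => ENNReal.ofReal_lt_top)]
  simp only [ENNReal.toReal_ofReal (hf0 _)]

lemma integral_lawOfDensity (hf : Measurable f) (hf0 : ∀ a, 0 ≤ f a) (g : α → E) :
    ∫ a, g a ∂(lawOfDensity f) = ∫ a, f a • g a := by
  rw [lawOfDensity, integral_withDensity_eq_integral_toReal_smul hf.ennreal_ofReal
    (ae_of_all _ fun _ => ENNReal.ofReal_lt_top)]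
  simp only [ENNReal.toReal_ofReal (hf0 _)]

lemma lintegral_lawOfDensity (hf : Measurable f) (g : α → ℝ≥0∞) :
    ∫⁻ a, g a ∂(lawOfDensity f) = ∫⁻ a, ENNReal.ofReal (f a) * g a := by
  rw [lawOfDensity, lintegral_withDensity_eq_lintegral_mul_non_measurable _ hf.ennreal_ofReal
    (ae_of_all _ fun _ => ENNReal.ofReal_lt_top)]
  simp only [Pi.mul_apply]

lemma isProbabilityMeasure_lawOfDensity (hf0 : ∀ a, 0 ≤ f a) (hf : Integrable f)
    (h1 : ∫ a, f a = 1) : IsProbabilityMeasure (lawOfDensity f) := by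
  refine ⟨?_⟩
  rw [lawOfDensity, withDensity_apply _ MeasurableSet.univ, Measure.restrict_univ,
    ← ofReal_integral_eq_lintegral_ofReal hf (ae_of_all _ hf0), h1, ENNReal.ofReal_one]

end LawOfDensity

/-- The shear `(z, e) ↦ (z, e + g z)` of a product. -/
def shearHomeomorph {E F : Type*} [TopologicalSpace E] [TopologicalSpace F] [AddCommGroup F]
    [IsTopologicalAddGroup F] (g : E → F) (hg : Continuous g) : E × F ≃ₜ E × F where
  toFun s := (s.1, s.2 + g s.1)
  invFun s := (s.1, s.2 - g s.1)
  left_inv s := by simp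
  right_inv s := by simp
  continuous_toFun := by fun_prop
  continuous_invFun := by fun_prop

/-- On each fibre the shear is a translation. -/
lemma measurePreserving_shearHomeomorph {m d : ℕ} (g : Vec m → Vec d) (hg : Continuous g) :
    MeasurePreserving (shearHomeomorph g hg) := by
  rw [Measure.volume_eq_prod]
  refine (MeasurePreserving.id volume).skew_product
    (g := fun z e => e + g z) ?_ (ae_of_all _ fun z => ?_)
  · exact (by fun_prop : Continuous fun s : Vec m × Vec d => s.2 + g s.1).measurable
  · exact map_add_right_eq_self volume (g z)

section Model

variable {p m d : ℕ} {NN : NeuralNetwork p m d} {θ : Param p d}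

lemma jointDensity_eq (NN : NeuralNetwork p m d) (θ : Param p d) (z : Vec m) (x : Vec d) :
    jointDensity NN θ z x = diagGaussianDensity 1 z *
      diagGaussianDensity (fun i => (θ.variance i).toNNReal) (x - NN.eval θ.weights z) := by
  rw [jointDensity, priorDensity_eq, likelihoodDensity_eq]

lemma jointDensity_nonneg (NN : NeuralNetwork p m d) (θ : Param p d) (z : Vec m) (x : Vec d) :
    0 ≤ jointDensity NN θ z x := by
  rw [jointDensity_eq]
  exact mul_nonneg (diagGaussianDensity_nonneg _ _) (diagGaussianDensity_nonneg _ _)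

lemma toNNReal_variance_ne_zero (hθ : ∀ i, 0 < θ.variance i) (i : Fin d) :
    (θ.variance i).toNNReal ≠ 0 := by simpa using hθ i

lemma jointDensity_pos (NN : NeuralNetwork p m d) (hθ : ∀ i, 0 < θ.variance i) (z : Vec m)
    (x : Vec d) : 0 < jointDensity NN θ z x := by
  rw [jointDensity_eq]
  exact mul_pos (diagGaussianDensity_pos (fun _ => one_ne_zero) _)
    (diagGaussianDensity_pos (toNNReal_variance_ne_zero hθ) _)

namespace NeuralNetwork.LipschitzNonlinearities

lemma continuous_eval_right (w : Vec p) (hNN : NN.LipschitzNonlinearities) :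
    Continuous (NN.eval w) :=
  hNN.continuous_eval.comp (continuous_const.prodMk continuous_id)

lemma continuous_jointDensity (θ : Param p d) (hNN : NN.LipschitzNonlinearities) :
    Continuous fun s : Vec m × Vec d => jointDensity NN θ s.1 s.2 := by
  simp only [jointDensity_eq]
  have h := hNN.continuous_eval_right θ.weights
  exact ((continuous_diagGaussianDensity _).comp continuous_fst).mul
    ((continuous_diagGaussianDensity _).comp (by fun_prop))

/-- In the coordinates `(z, e)` with `e = x - NN_w(z)` the joint density is a product of two
Gaussian densities, so integrability under the model reduces to Gaussian moments. -/
lemma integrable_mul_jointDensity_iff (θ : Param p d) (hNN : NN.LipschitzNonlinearities)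
    (F : Vec m → Vec d → ℝ) :
    Integrable (fun s : Vec m × Vec d =>
        F s.1 (s.2 - NN.eval θ.weights s.1) * jointDensity NN θ s.1 s.2) ↔
      Integrable (fun s : Vec m × Vec d => F s.1 s.2 * (diagGaussianDensity 1 s.1 *
        diagGaussianDensity (fun i => (θ.variance i).toNNReal) s.2)) := by
  rw [← (measurePreserving_shearHomeomorph _
    (hNN.continuous_eval_right θ.weights)).integrable_comp_emb (Homeomorph.measurableEmbedding _)]
  refine integrable_congr (ae_of_all _ fun s => ?_)
  simp [shearHomeomorph, jointDensity_eq]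

lemma integrable_jointDensity (θ : Param p d) (hNN : NN.LipschitzNonlinearities) :
    Integrable fun s : Vec m × Vec d => jointDensity NN θ s.1 s.2 := by
  have h := (hNN.integrable_mul_jointDensity_iff θ fun _ _ => 1).2
  simp only [one_mul] at h
  exact h ((integrable_diagGaussianDensity _).mul_prod (integrable_diagGaussianDensity _))

lemma integral_jointDensity (hθ : ∀ i, 0 < θ.variance i) (hNN : NN.LipschitzNonlinearities) :
    ∫ s : Vec m × Vec d, jointDensity NN θ s.1 s.2 = 1 := by
  rw [← (measurePreserving_shearHomeomorph _ (hNN.continuous_eval_right θ.weights)).integral_comp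
    (Homeomorph.measurableEmbedding _)]
  have h := integral_prod_mul (μ := (volume : Measure (Vec m))) (ν := (volume : Measure (Vec d)))
    (diagGaussianDensity 1) (diagGaussianDensity fun i => (θ.variance i).toNNReal)
  rw [integral_diagGaussianDensity (v := 1) (fun _ => one_ne_zero),
    integral_diagGaussianDensity (toNNReal_variance_ne_zero hθ), one_mul] at h
  rw [← h, Measure.volume_eq_prod]
  simp [shearHomeomorph, jointDensity_eq]

lemma isProbabilityMeasure_jointLaw (hθ : ∀ i, 0 < θ.variance i)
    (hNN : NN.LipschitzNonlinearities) : IsProbabilityMeasure (jointLaw NN θ) :=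
  isProbabilityMeasure_lawOfDensity (fun _ => jointDensity_nonneg _ _ _ _)
    (hNN.integrable_jointDensity θ) (hNN.integral_jointDensity hθ)

lemma jointDensity_le (NN : NeuralNetwork p m d) (θ : Param p d) : ∃ C, 0 ≤ C ∧
    ∀ z x, jointDensity NN θ z x ≤ C * diagGaussianDensity 1 z :=
  ⟨∏ i, (√(2 * Real.pi * (θ.variance i).toNNReal))⁻¹, Finset.prod_nonneg fun _ _ => by positivity,
    fun z x => by
      rw [jointDensity_eq, mul_comm]
      exact mul_le_mul_of_nonneg_right (diagGaussianDensity_le _ _)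
        (diagGaussianDensity_nonneg _ _)⟩

lemma integrable_jointDensity_right (θ : Param p d) (hNN : NN.LipschitzNonlinearities)
    (x : Vec d) : Integrable fun z => jointDensity NN θ z x := by
  obtain ⟨C, hC, h⟩ := jointDensity_le NN θ
  refine ((integrable_diagGaussianDensity 1).const_mul C).mono'
    ((hNN.continuous_jointDensity θ).comp
      (continuous_id.prodMk continuous_const)).aestronglyMeasurable (ae_of_all _ fun z => ?_)
  rw [Real.norm_of_nonneg (jointDensity_nonneg _ _ _ _)]
  exact h z x

lemma marginalDensity_pos (hθ : ∀ i, 0 < θ.variance i) (hNN : NN.LipschitzNonlinearities)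
    (x : Vec d) : 0 < marginalDensity NN θ x := by
  rw [marginalDensity, integral_pos_iff_support_of_nonneg (fun z => jointDensity_nonneg _ _ _ _)
    (hNN.integrable_jointDensity_right θ x)]
  have : Function.support (fun z => jointDensity NN θ z x) = Set.univ :=
    Set.eq_univ_of_forall fun z => (jointDensity_pos NN hθ z x).ne'
  rw [this]
  exact isOpen_univ.measure_pos volume Set.univ_nonempty

lemma measurable_marginalDensity (θ : Param p d) (hNN : NN.LipschitzNonlinearities) :
    Measurable (marginalDensity NN θ) :=
  ((hNN.continuous_jointDensity θ).stronglyMeasurable.integral_prod_left'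
    (μ := (volume : Measure (Vec m)))).measurable

lemma posteriorDensity_nonneg (hθ : ∀ i, 0 < θ.variance i) (hNN : NN.LipschitzNonlinearities)
    (x : Vec d) (z : Vec m) : 0 ≤ posteriorDensity NN θ x z :=
  div_nonneg (jointDensity_nonneg _ _ _ _) (hNN.marginalDensity_pos hθ x).le

lemma measurable_posteriorDensity (θ : Param p d) (hNN : NN.LipschitzNonlinearities) :
    Measurable fun s : Vec m × Vec d => posteriorDensity NN θ s.2 s.1 :=
  (hNN.continuous_jointDensity θ).measurable.div
    ((hNN.measurable_marginalDensity θ).comp measurable_snd)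

lemma measurable_posteriorDensity_right (θ : Param p d) (hNN : NN.LipschitzNonlinearities)
    (x : Vec d) : Measurable (posteriorDensity NN θ x) :=
  ((hNN.continuous_jointDensity θ).comp
    (continuous_id.prodMk continuous_const)).measurable.div_const _

lemma marginalDensity_mul_posteriorDensity (hθ : ∀ i, 0 < θ.variance i)
    (hNN : NN.LipschitzNonlinearities) (x : Vec d) (z : Vec m) :
    marginalDensity NN θ x * posteriorDensity NN θ x z = jointDensity NN θ z x :=
  mul_div_cancel₀ _ (hNN.marginalDensity_pos hθ x).ne'

lemma isProbabilityMeasure_posteriorLaw (hθ : ∀ i, 0 < θ.variance i)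
    (hNN : NN.LipschitzNonlinearities) (x : Vec d) :
    IsProbabilityMeasure (posteriorLaw NN θ x) := by
  refine isProbabilityMeasure_lawOfDensity (hNN.posteriorDensity_nonneg hθ x)
    ((hNN.integrable_jointDensity_right θ x).div_const _) ?_
  simp only [posteriorDensity]
  rw [integral_div]
  exact div_self (hNN.marginalDensity_pos hθ x).ne'

/-- Tonelli's theorem and the factorisation of the joint density as marginal times posterior; the
latter is legitimate at every `x` because the marginal density is positive everywhere. -/
lemma lintegral_jointLaw (hθ : ∀ i, 0 < θ.variance i) (hNN : NN.LipschitzNonlinearities)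
    {f : Vec m × Vec d → ℝ≥0∞} (hf : Measurable f) :
    ∫⁻ s, f s ∂(jointLaw NN θ)
      = ∫⁻ x, ∫⁻ z, f (z, x) ∂(posteriorLaw NN θ x) ∂(marginalLaw NN θ) := by
  have hj := (hNN.continuous_jointDensity θ).measurable
  rw [jointLaw, lintegral_lawOfDensity hj, Measure.volume_eq_prod,
    lintegral_prod_symm' (fun s => ENNReal.ofReal (jointDensity NN θ s.1 s.2) * f s)
      (hj.ennreal_ofReal.mul hf), marginalLaw,
    lintegral_lawOfDensity (hNN.measurable_marginalDensity θ)]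
  refine lintegral_congr fun x => ?_
  rw [posteriorLaw, lintegral_lawOfDensity (hNN.measurable_posteriorDensity_right θ x),
    ← lintegral_const_mul' _ _ ENNReal.ofReal_ne_top]
  refine lintegral_congr fun z => ?_
  rw [← mul_assoc, ← ENNReal.ofReal_mul (hNN.marginalDensity_pos hθ x).le,
    hNN.marginalDensity_mul_posteriorDensity hθ]

lemma map_snd_jointLaw (hθ : ∀ i, 0 < θ.variance i) (hNN : NN.LipschitzNonlinearities) :
    (jointLaw NN θ).map Prod.snd = marginalLaw NN θ := by
  refine Measure.ext_of_lintegral _ fun f hf => ?_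
  rw [lintegral_map hf measurable_snd, 
    hNN.lintegral_jointLaw hθ (f := fun s => f s.2) (hf.comp measurable_snd)]
  refine lintegral_congr fun x => ?_
  have := hNN.isProbabilityMeasure_posteriorLaw hθ x
  simp

lemma integral_jointLaw (hθ : ∀ i, 0 < θ.variance i) (hNN : NN.LipschitzNonlinearities)
    {E : Type*} [NormedAddCommGroup E] [NormedSpace ℝ E] {f : Vec m × Vec d → E}
    (hf : Integrable f (jointLaw NN θ)) :
    ∫ s, f s ∂(jointLaw NN θ)
      = ∫ x, ∫ z, f (z, x) ∂(posteriorLaw NN θ x) ∂(marginalLaw NN θ) := by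
  have hj := (hNN.continuous_jointDensity θ).measurable
  rw [jointLaw, integrable_lawOfDensity_iff hj fun _ => jointDensity_nonneg _ _ _ _,
    Measure.volume_eq_prod] at hf
  rw [jointLaw, integral_lawOfDensity hj fun _ => jointDensity_nonneg _ _ _ _,
    Measure.volume_eq_prod, integral_prod_symm _ hf, marginalLaw,
    integral_lawOfDensity (hNN.measurable_marginalDensity θ)
      fun x => (hNN.marginalDensity_pos hθ x).le]
  refine integral_congr_ae (ae_of_all _ fun x => ?_)
  beta_reduce
  rw [posteriorLaw, integral_lawOfDensity (hNN.measurable_posteriorDensity_right θ x)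
    (hNN.posteriorDensity_nonneg hθ x), ← integral_smul]
  refine integral_congr_ae (ae_of_all _ fun z => ?_)
  beta_reduce
  rw [smul_smul, hNN.marginalDensity_mul_posteriorDensity hθ]

end NeuralNetwork.LipschitzNonlinearities

end Model

/-! ### Square-integrability of the score and of the regression target -/

lemma enorm_integral_sq_le {Ω E : Type*} [MeasurableSpace Ω] [NormedAddCommGroup E]
    [NormedSpace ℝ E] {μ : Measure Ω} [IsProbabilityMeasure μ] {f : Ω → E}
    (hf : AEStronglyMeasurable f μ) : ‖∫ a, f a ∂μ‖ₑ ^ 2 ≤ ∫⁻ a, ‖f a‖ₑ ^ 2 ∂μ := by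
  have h : eLpNorm f 1 μ ≤ eLpNorm f 2 μ :=
    eLpNorm_le_eLpNorm_of_exponent_le (by norm_num) hf
  rw [eLpNorm_one_eq_lintegral_enorm] at h
  calc ‖∫ a, f a ∂μ‖ₑ ^ 2 ≤ (eLpNorm f 2 μ) ^ 2 := by
        gcongr
        exact (enorm_integral_le_lintegral_enorm f).trans h
    _ = _ := by
      simpa using eLpNorm_nnreal_pow_eq_lintegral (f := f) (μ := μ) (p := 2) (by norm_num)

section Target

variable {p m d : ℕ} {NN : NeuralNetwork p m d} {θ : Param p d}

namespace NeuralNetwork.LipschitzNonlinearities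

lemma memLp_scoreFormula (hθ : ∀ i, 0 < θ.variance i) (hNN : NN.LipschitzNonlinearities) :
    MemLp (fun s : Vec m × Vec d => scoreFormula NN θ s.1 s.2) 2 (jointLaw NN θ) := by
  have hm := measurable_scoreFormula hNN θ
  obtain ⟨C, hC, h⟩ := exists_norm_scoreFormula_le hNN θ
  rw [memLp_two_iff_integrable_sq_norm hm.aestronglyMeasurable, jointLaw,
    integrable_lawOfDensity_iff (hNN.continuous_jointDensity θ).measurable
      fun _ => jointDensity_nonneg _ _ _ _]
  have hv := toNNReal_variance_ne_zero hθ
  have h1 : ∀ i : Fin m, (1 : Fin m → ℝ≥0) i ≠ 0 := fun _ => one_ne_zero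
  -- The factor `3` comes from `(1 + a + b)² ≤ 3 (1 + a² + b²)` with `a = ‖z‖²` and `b = ‖e‖²`.
  have hint : Integrable fun s : Vec m × Vec d =>
      (3 * C ^ 2 * (1 + ‖s.1‖ ^ 4 + ‖s.2 - NN.eval θ.weights s.1‖ ^ 4))
        * jointDensity NN θ s.1 s.2 := by
    refine (hNN.integrable_mul_jointDensity_iff θ fun z e =>
      3 * C ^ 2 * (1 + ‖z‖ ^ 4 + ‖e‖ ^ 4)).2 ?_
    have i1 := (integrable_diagGaussianDensity (1 : Fin m → ℝ≥0)).mul_prod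
      (integrable_diagGaussianDensity fun i => (θ.variance i).toNNReal)
    have i2 := (integrable_norm_pow_four_mul_diagGaussianDensity h1).mul_prod
      (integrable_diagGaussianDensity fun i => (θ.variance i).toNNReal)
    have i3 := (integrable_diagGaussianDensity (1 : Fin m → ℝ≥0)).mul_prod
      (integrable_norm_pow_four_mul_diagGaussianDensity hv)
    rw [← Measure.volume_eq_prod] at i1 i2 i3
    refine (((i1.add i2).add i3).const_mul (3 * C ^ 2)).congr (ae_of_all _ fun s => ?_)
    simp only [Pi.add_apply]
    ring
  refine hint.mono' ((hNN.continuous_jointDensity θ).measurable.smul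
    (hm.norm.pow_const 2)).aestronglyMeasurable (ae_of_all _ fun s => ?_)
  have hj := jointDensity_nonneg NN θ s.1 s.2
  rw [Real.norm_of_nonneg (smul_nonneg hj (by positivity)), smul_eq_mul, mul_comm]
  refine mul_le_mul_of_nonneg_right ?_ hj
  calc ‖scoreFormula NN θ s.1 s.2‖ ^ 2
      ≤ (C * (1 + ‖s.1‖ ^ 2 + ‖s.2 - NN.eval θ.weights s.1‖ ^ 2)) ^ 2 := by
        gcongr; exact h _ _
    _ ≤ _ := by
      have : ∀ a b : ℝ, (C * (1 + a + b)) ^ 2 ≤ 3 * C ^ 2 * (1 + a ^ 2 + b ^ 2) := fun a b => by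
        rw [mul_pow, mul_comm (3 : ℝ), mul_assoc]
        refine mul_le_mul_of_nonneg_left ?_ (sq_nonneg C)
        nlinarith [sq_nonneg (a - 1), sq_nonneg (b - 1), sq_nonneg (a - b)]
      refine (this _ _).trans_eq ?_
      ring

/-- Joint integrability would give this only for almost every `x`. For each fixed `x`, the
likelihood is bounded, so the posterior density is at most a multiple of the prior density, and the
score grows polynomially in `z`. -/
lemma integrable_scoreFormula (hθ : ∀ i, 0 < θ.variance i) (hNN : NN.LipschitzNonlinearities)
    (x : Vec d) : Integrable (fun z => scoreFormula NN θ z x) (posteriorLaw NN θ x) := by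
  have hm : Measurable fun z => scoreFormula NN θ z x :=
    Measurable.comp (g := fun s : Vec m × Vec d => scoreFormula NN θ s.1 s.2) (f := fun z => (z, x))
      (measurable_scoreFormula hNN θ) measurable_prodMk_right
  obtain ⟨C, hC, h⟩ := exists_norm_scoreFormula_le hNN θ
  obtain ⟨K, hK, hj⟩ := jointDensity_le NN θ
  obtain ⟨A, hA, hev⟩ := hNN.exists_norm_eval_le ‖θ.weights‖
  have h1 : ∀ i : Fin m, (1 : Fin m → ℝ≥0) i ≠ 0 := fun _ => one_ne_zero
  rw [posteriorLaw, integrable_lawOfDensity_iff (hNN.measurable_posteriorDensity_right θ x)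
    (hNN.posteriorDensity_nonneg hθ x)]
  set M := marginalDensity NN θ x with hM
  have hMpos : 0 < M := hNN.marginalDensity_pos hθ x
  -- With `x` fixed, `1` and `‖z‖²` are each at most `1 + ‖z‖⁴`, and `‖e‖²` is at most `(2‖x‖² +
  -- 8A²)(1 + ‖z‖⁴)`; the `3` leaves some slack.
  have hint : Integrable fun z : Vec m =>
      (K / M * (C * (3 + 2 * ‖x‖ ^ 2 + 8 * A ^ 2))) *
        ((1 + ‖z‖ ^ 4) * diagGaussianDensity 1 z) := by
    refine (((integrable_diagGaussianDensity 1).add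
      (integrable_norm_pow_four_mul_diagGaussianDensity h1)).congr
        (ae_of_all _ fun z => ?_)).const_mul _
    simp only [Pi.add_apply]
    ring
  refine hint.mono' ((hNN.measurable_posteriorDensity_right θ x).smul hm).aestronglyMeasurable
    (ae_of_all _ fun z => ?_)
  have hg := diagGaussianDensity_nonneg (1 : Fin m → ℝ≥0) z
  rw [norm_smul, Real.norm_of_nonneg (hNN.posteriorDensity_nonneg hθ x z), posteriorDensity, ← hM]
  have hz := norm_nonneg z
  have hz4 : ‖z‖ ^ 2 ≤ 1 + ‖z‖ ^ 4 := by nlinarith [sq_nonneg (‖z‖ ^ 2 - 1)]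
  have he : ‖x - NN.eval θ.weights z‖ ^ 2 ≤ (2 * ‖x‖ ^ 2 + 8 * A ^ 2) * (1 + ‖z‖ ^ 4) := by
    have e1 : ‖x - NN.eval θ.weights z‖ ≤ ‖x‖ + A * (1 + ‖z‖) :=
      (norm_sub_le _ _).trans (by gcongr; exact hev _ le_rfl z)
    calc _ ≤ (‖x‖ + A * (1 + ‖z‖)) ^ 2 := by gcongr
      _ ≤ 2 * ‖x‖ ^ 2 + A ^ 2 * (4 + 4 * ‖z‖ ^ 2) := by
        nlinarith [sq_nonneg (‖x‖ - A * (1 + ‖z‖)), mul_nonneg (sq_nonneg A) (sq_nonneg (1 - ‖z‖))]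
      _ ≤ 2 * ‖x‖ ^ 2 * (1 + ‖z‖ ^ 4) + A ^ 2 * (8 * (1 + ‖z‖ ^ 4)) := by
        refine add_le_add ?_ (mul_le_mul_of_nonneg_left ?_ (sq_nonneg A))
        · exact le_mul_of_one_le_right (by positivity) (by linarith [pow_nonneg hz 4])
        · nlinarith [pow_nonneg hz 4]
      _ = _ := by ring
  calc _ ≤ K * diagGaussianDensity 1 z / M *
        (C * (1 + ‖z‖ ^ 2 + ‖x - NN.eval θ.weights z‖ ^ 2)) := by
        gcongr
        · exact hj z x
        · exact h z x
    _ ≤ K * diagGaussianDensity 1 z / M *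
        (C * ((3 + 2 * ‖x‖ ^ 2 + 8 * A ^ 2) * (1 + ‖z‖ ^ 4))) := by
        gcongr
        nlinarith [pow_nonneg hz 4]
    _ = _ := by ring

/-- The measure varies with `x`; rewriting the integral against Lebesgue measure moves this
dependence into a jointly measurable integrand. -/
lemma stronglyMeasurable_integral_scoreFormula (hθ : ∀ i, 0 < θ.variance i)
    (hNN : NN.LipschitzNonlinearities) :
    StronglyMeasurable fun x => ∫ z, scoreFormula NN θ z x ∂(posteriorLaw NN θ x) := by
  have h : (fun x => ∫ z, scoreFormula NN θ z x ∂(posteriorLaw NN θ x)) =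
      fun x => ∫ z, posteriorDensity NN θ x z • scoreFormula NN θ z x := by
    ext1 x
    rw [posteriorLaw, integral_lawOfDensity (hNN.measurable_posteriorDensity_right θ x)
      (hNN.posteriorDensity_nonneg hθ x)]
  rw [h]
  exact ((hNN.measurable_posteriorDensity θ).smul
    (measurable_scoreFormula hNN θ)).stronglyMeasurable.integral_prod_left'
      (μ := (volume : Measure (Vec m)))

lemma memLp_integral_scoreFormula (hθ : ∀ i, 0 < θ.variance i)
    (hNN : NN.LipschitzNonlinearities) :
    MemLp (fun x => ∫ z, scoreFormula NN θ z x ∂(posteriorLaw NN θ x)) 2 (marginalLaw NN θ) := by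
  refine ⟨(hNN.stronglyMeasurable_integral_scoreFormula hθ).aestronglyMeasurable, ?_⟩
  have h := (hNN.memLp_scoreFormula hθ).2
  rw [eLpNorm_lt_top_iff_lintegral_rpow_enorm_lt_top (by norm_num) (by norm_num)] at h ⊢
  simp only [ENNReal.toReal_ofNat, ENNReal.rpow_ofNat] at h ⊢
  refine lt_of_le_of_lt ?_ h
  rw [hNN.lintegral_jointLaw hθ
    (f := fun s => ‖scoreFormula NN θ s.1 s.2‖ₑ ^ 2)
    ((measurable_scoreFormula hNN θ).enorm.pow_const 2)]
  refine lintegral_mono fun x => ?_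
  have := hNN.isProbabilityMeasure_posteriorLaw hθ x
  exact enorm_integral_sq_le (hNN.integrable_scoreFormula hθ x).aestronglyMeasurable

/-- The tower property, tested against functions of `x`. It is the only link between score and
target that the regression argument uses. -/
lemma integral_inner_scoreFormula (hθ : ∀ i, 0 < θ.variance i)
    (hNN : NN.LipschitzNonlinearities) {h : Vec d → Param p d}
    (hh : Integrable (fun s => inner ℝ (scoreFormula NN θ s.1 s.2) (h s.2)) (jointLaw NN θ)) :
    ∫ s, inner ℝ (scoreFormula NN θ s.1 s.2) (h s.2) ∂(jointLaw NN θ) =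
      ∫ x, inner ℝ (∫ z, scoreFormula NN θ z x ∂(posteriorLaw NN θ x)) (h x)
        ∂(marginalLaw NN θ) := by
  rw [hNN.integral_jointLaw hθ hh]
  refine integral_congr_ae (ae_of_all _ fun x => ?_)
  beta_reduce
  rw [real_inner_comm, ← integral_inner (hNN.integrable_scoreFormula hθ x)]
  simp only [real_inner_comm]

end NeuralNetwork.LipschitzNonlinearities

lemma scoreGradient_ae_eq_posteriorLaw
    (hDiff : ∀ᵐ z : Vec m, DifferentiableAt ℝ (fun w => NN.eval w z) θ.weights)
    (hθ : ∀ i, 0 < θ.variance i) (x : Vec d) :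
    (fun z => scoreGradient NN θ z x) =ᵐ[posteriorLaw NN θ x] fun z => scoreFormula NN θ z x :=
  (withDensity_absolutelyContinuous _ _).ae_le
    (hDiff.mono fun _ hz => scoreGradient_eq_scoreFormula hz hθ x)

lemma scoreGradient_ae_eq_jointLaw
    (hDiff : ∀ᵐ z : Vec m, DifferentiableAt ℝ (fun w => NN.eval w z) θ.weights)
    (hθ : ∀ i, 0 < θ.variance i) :
    (fun s : Vec m × Vec d => scoreGradient NN θ s.1 s.2) =ᵐ[jointLaw NN θ]
      fun s => scoreFormula NN θ s.1 s.2 := by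
  refine (withDensity_absolutelyContinuous _ _).ae_le ?_
  exact (Measure.quasiMeasurePreserving_fst.ae hDiff).mono
    fun _ hz => scoreGradient_eq_scoreFormula hz hθ _

lemma gradientTarget_eq
    (hDiff : ∀ᵐ z : Vec m, DifferentiableAt ℝ (fun w => NN.eval w z) θ.weights)
    (hθ : ∀ i, 0 < θ.variance i) (x : Vec d) :
    gradientTarget NN θ x = ∫ z, scoreFormula NN θ z x ∂(posteriorLaw NN θ x) :=
  integral_congr_ae (scoreGradient_ae_eq_posteriorLaw hDiff hθ x)

end Target

/-! ### Ridge regression in Hilbert spaces -/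

section HilbertRidge

variable {H E : Type*} [NormedAddCommGroup H] [InnerProductSpace ℝ H]
  [NormedAddCommGroup E] [InnerProductSpace ℝ E]

/-- Lax–Milgram for `A*A + lam`, coercive with constant `lam`. Stated for a general bounded `A` so
as to serve both the sampling operator and the inclusion into `L²`. -/
lemma exists_ridge_normalEquation [CompleteSpace H] [CompleteSpace E] (A : H →L[ℝ] E) (b : E)
    {lam : ℝ} (hlam : 0 < lam) :
    ∃ f : H, ∀ h, inner ℝ (b - A f) (A h) = lam * inner ℝ f h := by
  let T : H →L[ℝ] H := A.adjoint ∘L A + lam • ContinuousLinearMap.id ℝ H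
  have hT : ∀ u v, inner ℝ (T u) v = inner ℝ (A u) (A v) + lam * inner ℝ u v := fun u v => by
    simp [T, inner_add_left, inner_smul_left, ContinuousLinearMap.adjoint_inner_left]
  have hB : IsCoercive ((innerSL ℝ : H →L[ℝ] H →L[ℝ] ℝ) ∘L T) := ⟨lam, hlam, fun u => by
    change _ ≤ inner ℝ (T u) u
    rw [hT, real_inner_self_eq_norm_mul_norm, mul_assoc, real_inner_self_eq_norm_mul_norm]
    exact le_add_of_nonneg_left (by positivity)⟩
  refine ⟨hB.continuousLinearEquivOfBilin.symm (A.adjoint b), fun h => ?_⟩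
  set f := hB.continuousLinearEquivOfBilin.symm (A.adjoint b) with hf
  have h1 : inner ℝ (A.adjoint b) h = inner ℝ (T f) h := by
    rw [← hB.continuousLinearEquivOfBilin.apply_symm_apply (A.adjoint b), ← hf,
      hB.continuousLinearEquivOfBilin_apply]
    rfl
  rw [ContinuousLinearMap.adjoint_inner_left, hT] at h1
  rw [inner_sub_left, h1]
  ring

/-- Completing the square: the normal equation cancels the cross terms. The exact excess risk yields
both minimality and uniqueness. -/
lemma ridge_eq_add_of_normalEquation {A : H →L[ℝ] E} {b : E} {lam : ℝ} {f : H}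
    (hf : ∀ h, inner ℝ (b - A f) (A h) = lam * inner ℝ f h) (g : H) :
    ‖b - A g‖ ^ 2 + lam * ‖g‖ ^ 2 =
      ‖b - A f‖ ^ 2 + lam * ‖f‖ ^ 2 + ‖A (g - f)‖ ^ 2 + lam * ‖g - f‖ ^ 2 := by
  have h1 : b - A g = b - A f - A (g - f) := by simp
  have h2 : ‖g‖ ^ 2 = ‖f‖ ^ 2 + 2 * inner ℝ f (g - f) + ‖g - f‖ ^ 2 := by
    rw [← norm_add_sq_real, add_sub_cancel]
  rw [h1, norm_sub_sq_real, hf, h2]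
  ring

end HilbertRidge

/-! ### Reproducing kernel Hilbert spaces of functions vanishing at infinity -/

section RKHSBounds

variable {X V H : Type*} [NormedAddCommGroup V] [InnerProductSpace ℝ V] [CompleteSpace V]
  [NormedAddCommGroup H] [InnerProductSpace ℝ H] [CompleteSpace H] [RKHS ℝ H X V]

/-- Each `f` in `H` is bounded, so the evaluations, adjoint to `RKHS.kerFun`, form a pointwise
bounded family; Banach–Steinhaus makes the bound uniform. -/
lemma IsC0Universal.exists_norm_kerFun_le [TopologicalSpace X] (hH : IsC0Universal H) :
    ∃ κ : ℝ, 0 ≤ κ ∧ ∀ x : X, ‖RKHS.kerFun H x‖ ≤ κ := by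
  obtain ⟨κ, hκ⟩ := banach_steinhaus (g := fun x : X => (RKHS.kerFun H x).adjoint) fun f => by
    let f₀ : C₀(X, V) := ⟨⟨f, (hH.1 f).1⟩, (hH.1 f).2⟩
    refine ⟨‖f₀.toBCF‖, fun x => ?_⟩
    rw [RKHS.adjoint_kerFun]
    exact f₀.toBCF.norm_coe_le_norm x
  refine ⟨max κ 0, le_max_right _ _, fun x => le_max_of_le_left ?_⟩
  simpa using hκ x

lemma RKHS.norm_apply_le_of_norm_kerFun_le {κ : ℝ} (hκ : ∀ x : X, ‖RKHS.kerFun H x‖ ≤ κ) (f : H)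
    (x : X) : ‖f x‖ ≤ κ * ‖f‖ := by
  rw [← RKHS.adjoint_kerFun]
  refine (ContinuousLinearMap.le_opNorm _ _).trans ?_
  gcongr
  simpa using hκ x

/-- The kernel is continuous in its first variable because its sections lie in `H`, and in its
second by Hermitian symmetry. Separate continuity gives joint measurability. -/
lemma RKHS.measurable_kernel [FiniteDimensional ℝ V] [TopologicalSpace X]
    [TopologicalSpace.MetrizableSpace X] [SecondCountableTopology X] [MeasurableSpace X]
    [BorelSpace X] (hH : ∀ f : H, Continuous f) :
    Measurable fun a : X × X => RKHS.kernel H a.1 a.2 := by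
  have hleft : ∀ y, Continuous fun x => RKHS.kernel H x y := fun y => by
    refine continuous_clm_apply.2 fun v => ?_
    simp only [← RKHS.kerFun_apply]
    exact hH _
  have hright : ∀ x, Continuous fun y => RKHS.kernel H x y := fun x => by
    have : (fun y => RKHS.kernel H x y) = fun y => (RKHS.kernel H y x).adjoint := by
      ext1 y
      exact ((RKHS.isHermitian_kernel H).apply x y).symm
    rw [this]
    exact ContinuousLinearMap.adjoint.continuous.comp (hleft x)
  exact (stronglyMeasurable_uncurry_of_continuous_of_stronglyMeasurable hleft
    fun x => (hright x).stronglyMeasurable).measurable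

end RKHSBounds

/-! ### Kernel ridge regression on a sample -/

section Empirical

variable {X V H : Type*} [NormedAddCommGroup V] [InnerProductSpace ℝ V] [CompleteSpace V]
  [NormedAddCommGroup H] [InnerProductSpace ℝ H] [CompleteSpace H] [RKHS ℝ H X V]

lemma exists_krr_normalEquation {N : ℕ} {lam : ℝ} (hlam : 0 < lam) (x : Fin N → X)
    (y : Fin N → V) : ∃ f : H,
      (∀ h : H, (1 / (N : ℝ)) * ∑ n, inner ℝ (y n - f (x n)) (h (x n)) = lam * inner ℝ f h) ∧
      ∀ g : H, krrObjective lam x y f + lam * ‖g - f‖ ^ 2 ≤ krrObjective lam x y g := by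
  -- Scaling the sampled values by `N^(-1/2)` turns the empirical risk into a squared norm. For `N =
  -- 0` both `r ^ 2` and `1 / N` are `0`, so no case distinction arises.
  let r : ℝ := (√(N : ℝ))⁻¹
  have hr : r ^ 2 = 1 / (N : ℝ) := by simp [r, inv_pow]
  let L : (Fin N → V) →L[ℝ] PiLp 2 fun _ : Fin N => V :=
    (PiLp.continuousLinearEquiv 2 ℝ fun _ : Fin N => V).symm
  let A : H →L[ℝ] PiLp 2 fun _ : Fin N => V :=
    L ∘L ContinuousLinearMap.pi fun n => r • (RKHS.kerFun H (x n)).adjoint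
  let b : PiLp 2 fun _ : Fin N => V := WithLp.toLp 2 fun n => r • y n
  have hA : ∀ (f : H) n, A f n = r • f (x n) := fun f n => by simp [A, L]
  have hb : ∀ (f : H) n, (b - A f) n = r • (y n - f (x n)) := fun f n => by
    rw [PiLp.sub_apply, hA, smul_sub]
  obtain ⟨f, hf⟩ := exists_ridge_normalEquation A b hlam
  have hobj : ∀ g : H, krrObjective lam x y g = ‖b - A g‖ ^ 2 + lam * ‖g‖ ^ 2 := fun g => by
    rw [krrObjective, PiLp.norm_sq_eq_of_L2, Finset.mul_sum]
    simp only [hb, norm_smul, mul_pow, Real.norm_eq_abs, sq_abs, hr]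
  refine ⟨f, fun h => ?_, fun g => ?_⟩
  · rw [← hf h, PiLp.inner_apply, Finset.mul_sum]
    refine Finset.sum_congr rfl fun n _ => ?_
    rw [hb, hA, inner_smul_left, inner_smul_right, ← mul_assoc, ← hr, sq]
    rfl
  · rw [hobj, hobj, ridge_eq_add_of_normalEquation hf g]
    nlinarith [sq_nonneg ‖A (g - f)‖]

/-- The averaged vector is `-1/2` times the gradient of the empirical risk at `f₀`. Its inner
product with `f - f₀` is `lam ‖f - f₀‖²` plus the nonnegative empirical mean of `‖(f - f₀)(xₙ)‖²`.
-/
lemma norm_sub_le_of_krr_normalEquation {N : ℕ} (hN : N ≠ 0) {lam : ℝ}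
    {x : Fin N → X} {y : Fin N → V} {f : H}
    (hf : ∀ h : H, (1 / (N : ℝ)) * ∑ n, inner ℝ (y n - f (x n)) (h (x n)) = lam * inner ℝ f h)
    (f₀ : H) :
    lam * ‖f - f₀‖ ≤
      ‖(1 / (N : ℝ)) • ∑ n, (RKHS.kerFun H (x n) (y n - f₀ (x n)) - lam • f₀)‖ := by
  set Δ := f - f₀ with hΔ
  set ζ := (1 / (N : ℝ)) • ∑ n, (RKHS.kerFun H (x n) (y n - f₀ (x n)) - lam • f₀) with hζ
  have hNR : (N : ℝ) ≠ 0 := Nat.cast_ne_zero.2 hN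
  have h1 : inner ℝ ζ Δ = (1 / (N : ℝ)) * ∑ n, inner ℝ (y n - f₀ (x n)) (Δ (x n))
      - lam * inner ℝ f₀ Δ := by
    rw [hζ, inner_smul_left, sum_inner]
    simp only [inner_sub_left, RKHS.kerFun_inner, inner_smul_left, Finset.sum_sub_distrib,
      Finset.sum_const, Finset.card_univ, Fintype.card_fin, nsmul_eq_mul, conj_trivial]
    field_simp
  have h2 : ∀ n, inner ℝ (y n - f₀ (x n)) (Δ (x n))
      = inner ℝ (y n - f (x n)) (Δ (x n)) + ‖Δ (x n)‖ ^ 2 := fun n => by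
    have : y n - f₀ (x n) = (y n - f (x n)) + Δ (x n) := by
      rw [hΔ, RKHS.coe_sub, Pi.sub_apply]; abel
    rw [this, inner_add_left, real_inner_self_eq_norm_sq]
  have h3 : inner ℝ f Δ = inner ℝ f₀ Δ + ‖Δ‖ ^ 2 := by
    rw [← real_inner_self_eq_norm_sq, ← inner_add_left, hΔ, add_sub_cancel]
  have h4 : lam * ‖Δ‖ ^ 2 ≤ ‖ζ‖ * ‖Δ‖ := by
    refine le_trans ?_ (real_inner_le_norm ζ Δ)
    rw [h1]
    simp only [h2]
    rw [Finset.sum_add_distrib, mul_add, hf Δ, h3]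
    have : 0 ≤ (1 / (N : ℝ)) * ∑ n, ‖Δ (x n)‖ ^ 2 :=
      mul_nonneg (by positivity) (Finset.sum_nonneg fun _ _ => sq_nonneg _)
    linarith
  rcases (norm_nonneg Δ).eq_or_lt with h0 | h0
  · rw [← h0, mul_zero]; exact norm_nonneg _
  · exact le_of_mul_le_mul_right (by rwa [mul_assoc, ← sq]) h0

end Empirical

/-! ### Kernel ridge regression on the population -/

section Population

variable {X V H : Type*} [NormedAddCommGroup V] [InnerProductSpace ℝ V] [CompleteSpace V]
  [NormedAddCommGroup H] [InnerProductSpace ℝ H] [CompleteSpace H] [RKHS ℝ H X V]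
  [TopologicalSpace X] [SecondCountableTopology X] [MeasurableSpace X] [BorelSpace X]
  {μ : Measure X} [IsProbabilityMeasure μ]

lemma IsC0Universal.memLp (hH : IsC0Universal H) (f : H) : MemLp (f : X → V) 2 μ := by
  obtain ⟨κ, hκ, h⟩ := hH.exists_norm_kerFun_le
  exact MemLp.of_bound (hH.1 f).1.aestronglyMeasurable (κ * ‖f‖)
    (ae_of_all _ (RKHS.norm_apply_le_of_norm_kerFun_le h f))

lemma exists_population_ridge (hH : IsC0Universal H) {y : X → V} (hy : MemLp y 2 μ) {lam : ℝ}
    (hlam : 0 < lam) : ∃ f : H,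
      (∀ h : H, ∫ x, inner ℝ (y x - f x) (h x) ∂μ = lam * inner ℝ f h) ∧
      ∀ g : H, ∫ x, ‖y x - f x‖ ^ 2 ∂μ + lam * ‖f‖ ^ 2
        ≤ ∫ x, ‖y x - g x‖ ^ 2 ∂μ + lam * ‖g‖ ^ 2 := by
  obtain ⟨κ, hκ, hbound⟩ := hH.exists_norm_kerFun_le
  have hmem := hH.memLp (μ := μ)
  let A₀ : H →ₗ[ℝ] Lp V 2 μ :=
    { toFun := fun f => (hmem f).toLp f
      map_add' := fun f g => by
        rw [← MemLp.toLp_add]; exact MemLp.toLp_congr _ _ (ae_of_all _ fun x => by simp)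
      map_smul' := fun c f => by
        rw [RingHom.id_apply, ← MemLp.toLp_const_smul]
        exact MemLp.toLp_congr _ _ (ae_of_all _ fun x => by simp) }
  let A : H →L[ℝ] Lp V 2 μ := A₀.mkContinuous κ fun f => by
    have := Lp.norm_le_of_ae_bound (f := (hmem f).toLp f) (μ := μ)
      (mul_nonneg hκ (norm_nonneg f))
      ((hmem f).coeFn_toLp.mono fun x hx => by
        rw [hx]; exact RKHS.norm_apply_le_of_norm_kerFun_le hbound f x)
    rw [show measureUnivNNReal μ = 1 by simp [measureUnivNNReal], NNReal.coe_one, Real.one_rpow,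
      one_mul] at this
    exact this
  have hA : ∀ f : H, A f = (hmem f).toLp f := fun f => rfl
  have hsub : ∀ f : H, hy.toLp y - A f = (hy.sub (hmem f)).toLp (y - (f : X → V)) := fun f => by
    rw [hA, MemLp.toLp_sub]
  have hnorm : ∀ f : H, ‖hy.toLp y - A f‖ ^ 2 = ∫ x, ‖y x - f x‖ ^ 2 ∂μ := fun f => by
    rw [hsub, ← real_inner_self_eq_norm_sq, L2.inner_def]
    refine integral_congr_ae ((hy.sub (hmem f)).coeFn_toLp.mono fun x hx => ?_)
    beta_reduce
    rw [hx, real_inner_self_eq_norm_sq]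
    rfl
  obtain ⟨f, hf⟩ := exists_ridge_normalEquation A (hy.toLp y) hlam
  refine ⟨f, fun h => ?_, fun g => ?_⟩
  · rw [← hf h, hsub, hA, L2.inner_def]
    refine integral_congr_ae ?_
    filter_upwards [(hy.sub (hmem f)).coeFn_toLp, (hmem h).coeFn_toLp] with x h1 h2
    rw [h1, h2]
    rfl
  · rw [← hnorm, ← hnorm, ridge_eq_add_of_normalEquation hf g]
    have : 0 ≤ lam * ‖g - f‖ ^ 2 := by positivity
    nlinarith [sq_nonneg ‖A (g - f)‖]

/-- Compactly supported continuous functions are dense in `L²`, and `H` approximates them uniformly,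
hence in `L²` of a probability measure. Each step spends `√ε / 2`. -/
lemma IsC0Universal.exists_integral_norm_sub_sq_le [LocallyCompactSpace X] [R1Space X]
    [μ.Regular] (hH : IsC0Universal H) {y : X → V} (hy : MemLp y 2 μ) {ε : ℝ} (hε : 0 < ε) :
    ∃ f : H, ∫ x, ‖y x - f x‖ ^ 2 ∂μ ≤ ε := by
  have hδ : 0 < √ε / 2 := by positivity
  obtain ⟨g, hgc, hgε, hg, hg2⟩ := hy.exists_hasCompactSupport_eLpNorm_sub_le (by norm_num)
    (ENNReal.ofReal_pos.2 hδ).ne'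
  let g₀ : C₀(X, V) := ⟨⟨g, hg⟩, hgc.is_zero_at_infty⟩
  obtain ⟨f, hf⟩ := hH.2 g₀ (√ε / 2) hδ
  have hfm := hH.memLp (μ := μ) f
  refine ⟨f, ?_⟩
  have h1 : eLpNorm (g - (f : X → V)) 2 μ ≤ ENNReal.ofReal (√ε / 2) := by
    have := eLpNorm_le_of_ae_bound (p := 2) (μ := μ) (f := g - (f : X → V)) (C := √ε / 2)
      (ae_of_all _ fun x => by rw [Pi.sub_apply, norm_sub_rev]; exact hf x)
    simpa using this
  have h2 : eLpNorm (y - (f : X → V)) 2 μ ≤ ENNReal.ofReal (√ε) := by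
    calc eLpNorm (y - (f : X → V)) 2 μ = eLpNorm ((y - g) + (g - (f : X → V))) 2 μ := by
          rw [sub_add_sub_cancel]
      _ ≤ eLpNorm (y - g) 2 μ + eLpNorm (g - (f : X → V)) 2 μ :=
        eLpNorm_add_le (hy.sub hg2).1 (hg2.sub hfm).1 (by norm_num)
      _ ≤ ENNReal.ofReal (√ε / 2) + ENNReal.ofReal (√ε / 2) := add_le_add hgε h1
      _ = _ := by rw [← ENNReal.ofReal_add hδ.le hδ.le, add_halves]
  have h3 := (hy.sub hfm).eLpNorm_eq_integral_rpow_norm (by norm_num) (by norm_num)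
  simp only [ENNReal.toReal_ofNat, Real.rpow_ofNat, Pi.sub_apply] at h3
  rw [h3, ENNReal.ofReal_le_ofReal_iff (Real.sqrt_nonneg _), ← one_div, ← Real.sqrt_eq_rpow,
    Real.sqrt_le_sqrt_iff hε.le] at h2
  exact h2

end Population

/-! ### Averages of independent centred random elements of a Hilbert space -/

lemma integrable_inner_of_sq {α V : Type*} [MeasurableSpace α] {μ : Measure α}
    [NormedAddCommGroup V] [InnerProductSpace ℝ V] {f g : α → V}
    (hfg : AEStronglyMeasurable (fun a => inner ℝ (f a) (g a)) μ)
    (hf : Integrable (fun a => ‖f a‖ ^ 2) μ) (hg : Integrable (fun a => ‖g a‖ ^ 2) μ) :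
    Integrable (fun a => inner ℝ (f a) (g a)) μ := by
  refine (hf.add hg).mono' hfg (ae_of_all _ fun a => ?_)
  rw [Pi.add_apply]
  have := norm_inner_le_norm (𝕜 := ℝ) (f a) (g a)
  nlinarith [sq_nonneg (‖f a‖ - ‖g a‖), sq_nonneg ‖f a‖, sq_nonneg ‖g a‖]

lemma MeasureTheory.MemLp.integrable_real_inner {α V : Type*} [MeasurableSpace α]
    {μ : Measure α} [NormedAddCommGroup V] [InnerProductSpace ℝ V] {f g : α → V}
    (hf : MemLp f 2 μ) (hg : MemLp g 2 μ) : Integrable (fun a => inner ℝ (f a) (g a)) μ :=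
  integrable_inner_of_sq (hf.1.inner hg.1) ((memLp_two_iff_integrable_sq_norm hf.1).1 hf)
    ((memLp_two_iff_integrable_sq_norm hg.1).1 hg)

section Average

variable {S H : Type*} [MeasurableSpace S] {P : Measure S} [IsProbabilityMeasure P]
  [NormedAddCommGroup H] [InnerProductSpace ℝ H] {ζ : S → H}

lemma map_pair_pi {N : ℕ} {i j : Fin N} (hij : i ≠ j) :
    (Measure.pi fun _ : Fin N => P).map (fun D => (D i, D j)) = P.prod P := by
  have h := (iIndepFun_pi (μ := fun _ : Fin N => P) (X := fun _ s => s)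
    fun _ => aemeasurable_id').indepFun hij
  rw [indepFun_iff_map_prod_eq_prod_map_map (measurable_pi_apply i).aemeasurable
    (measurable_pi_apply j).aemeasurable] at h
  rw [h]
  exact congrArg₂ _ (measurePreserving_eval (fun _ : Fin N => P) i).map_eq
    (measurePreserving_eval (fun _ : Fin N => P) j).map_eq

/-- Expanding the square leaves only the diagonal, as independence and centring remove the cross
terms. `H` carries no σ-algebra and need not be separable, so centring is weak and measurability is
asked only of inner products. -/
lemma integral_norm_average_sq
    (hmeas : Measurable fun a : S × S => inner ℝ (ζ a.1) (ζ a.2))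
    (hint : Integrable (fun s => ‖ζ s‖ ^ 2) P) (hzero : ∀ h, ∫ s, inner ℝ (ζ s) h ∂P = 0)
    {N : ℕ} (hN : N ≠ 0) :
    Integrable (fun D : Fin N → S => ‖(1 / (N : ℝ)) • ∑ n, ζ (D n)‖ ^ 2)
        (Measure.pi fun _ => P) ∧
      ∫ D : Fin N → S, ‖(1 / (N : ℝ)) • ∑ n, ζ (D n)‖ ^ 2 ∂(Measure.pi fun _ => P)
        = (1 / (N : ℝ)) * ∫ s, ‖ζ s‖ ^ 2 ∂P := by
  have hexp : ∀ D : Fin N → S, ‖(1 / (N : ℝ)) • ∑ n, ζ (D n)‖ ^ 2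
      = (1 / (N : ℝ)) ^ 2 * ∑ i, ∑ j, inner ℝ (ζ (D i)) (ζ (D j)) := fun D => by
    rw [norm_smul, mul_pow, Real.norm_eq_abs, sq_abs, ← real_inner_self_eq_norm_sq, sum_inner]
    simp only [inner_sum]
  have hev : ∀ i, Integrable (fun D : Fin N → S => ‖ζ (D i)‖ ^ 2) (Measure.pi fun _ => P) :=
    fun i => (measurePreserving_eval (fun _ : Fin N => P) i).integrable_comp_of_integrable hint
  have hpair : ∀ i j : Fin N, Measurable fun D : Fin N → S => (D i, D j) := fun i j =>
    (measurable_pi_apply i).prodMk (measurable_pi_apply j)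
  have hterm : ∀ i j, Integrable (fun D : Fin N → S => inner ℝ (ζ (D i)) (ζ (D j)))
      (Measure.pi fun _ => P) := fun i j =>
    integrable_inner_of_sq (hmeas.comp (hpair i j)).aestronglyMeasurable (hev i) (hev j)
  have hprod : Integrable (fun a : S × S => inner ℝ (ζ a.1) (ζ a.2)) (P.prod P) :=
    integrable_inner_of_sq hmeas.aestronglyMeasurable
      (measurePreserving_fst.integrable_comp_of_integrable hint)
      (measurePreserving_snd.integrable_comp_of_integrable hint)
  have hval : ∀ i j, ∫ D : Fin N → S, inner ℝ (ζ (D i)) (ζ (D j)) ∂(Measure.pi fun _ => P)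
      = if i = j then ∫ s, ‖ζ s‖ ^ 2 ∂P else 0 := fun i j => by
    split_ifs with hij
    · subst hij
      simp only [real_inner_self_eq_norm_sq]
      have hm := (measurePreserving_eval (fun _ : Fin N => P) i)
      have := integral_map (μ := Measure.pi fun _ : Fin N => P) (φ := Function.eval i)
        (measurable_pi_apply i).aemeasurable (f := fun s => ‖ζ s‖ ^ 2)
        (by rw [hm.map_eq]; exact hint.1)
      rw [hm.map_eq] at this
      exact this.symm
    · have := integral_map (μ := Measure.pi fun _ : Fin N => P) (hpair i j).aemeasurable
        (f := fun a : S × S => inner ℝ (ζ a.1) (ζ a.2)) hmeas.aestronglyMeasurable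
      rw [← this, map_pair_pi hij, integral_prod _ hprod]
      have h0 : ∀ h, ∫ s, inner ℝ h (ζ s) ∂P = 0 := fun h =>
        (integral_congr_ae (ae_of_all _ fun s => real_inner_comm _ _)).trans (hzero h)
      simp only [h0, integral_zero]
  simp only [hexp]
  have hsum := fun i (_ : i ∈ Finset.univ) =>
    integrable_finsetSum Finset.univ fun j _ => hterm i j
  refine ⟨(integrable_finsetSum _ hsum).const_mul _, ?_⟩
  rw [integral_const_mul, integral_finsetSum _ hsum]
  simp only [integral_finsetSum _ fun j _ => hterm _ j, hval, Finset.sum_ite_eq, Finset.mem_univ,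
    if_true, Finset.sum_const, Finset.card_univ, Fintype.card_fin, nsmul_eq_mul]
  have : (N : ℝ) ≠ 0 := Nat.cast_ne_zero.2 hN
  field_simp

end Average

/-! ### Consistency of kernel ridge regression -/

lemma Measurable.clm_apply_of_finiteDimensional {α V : Type*} [MeasurableSpace α]
    [NormedAddCommGroup V] [InnerProductSpace ℝ V] [FiniteDimensional ℝ V] [MeasurableSpace V]
    [BorelSpace V] {T : α → V →L[ℝ] V} {r : α → V} (hT : Measurable T) (hr : Measurable r) :
    Measurable fun a => T a (r a) := by
  have h : Measurable fun q : (V →L[ℝ] V) × V => q.1 q.2 :=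
    (isBoundedBilinearMap_apply (𝕜 := ℝ) (E := V) (F := V)).continuous.measurable
  exact h.comp (hT.prodMk hr)

section Consistency

variable {S X V H : Type*} [MeasurableSpace S] {P : Measure S} [IsProbabilityMeasure P]
  [NormedAddCommGroup V] [InnerProductSpace ℝ V] [FiniteDimensional ℝ V] [MeasurableSpace V]
  [BorelSpace V]
  [NormedAddCommGroup H] [InnerProductSpace ℝ H] [CompleteSpace H] [RKHS ℝ H X V]
  [TopologicalSpace X] [TopologicalSpace.MetrizableSpace X] [SecondCountableTopology X]
  [MeasurableSpace X] [BorelSpace X] {ξ : S → X} {Y : S → V} {y : X → V}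

/-- The reproducing property turns these inner products into values of the kernel and of functions
in `H`. -/
lemma measurable_inner_residual (hH : IsC0Universal H) (hξ : Measurable ξ) (hY : Measurable Y)
    (f₀ a : H) : Measurable fun q : S × S =>
      inner ℝ (RKHS.kerFun H (ξ q.1) (Y q.1 - f₀ (ξ q.1)) - a)
        (RKHS.kerFun H (ξ q.2) (Y q.2 - f₀ (ξ q.2)) - a) := by
  have hc : ∀ f : H, Measurable fun s => f (ξ s) := fun f => (hH.1 f).1.measurable.comp hξ
  set r : S → V := fun s => Y s - f₀ (ξ s) with hr_def
  have hr : Measurable r := hY.sub (hc f₀)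
  have hker : Measurable fun q : X × X => RKHS.kernel H q.1 q.2 :=
    RKHS.measurable_kernel fun f => (hH.1 f).1
  have hK : Measurable fun q : S × S => RKHS.kernel H (ξ q.2) (ξ q.1) :=
    Measurable.comp (g := fun q : X × X => RKHS.kernel H q.1 q.2)
      (f := fun q : S × S => (ξ q.2, ξ q.1)) hker
      ((hξ.comp measurable_snd).prodMk (hξ.comp measurable_fst))
  have hr1 : Measurable fun q : S × S => r q.1 := hr.comp measurable_fst
  have hr2 : Measurable fun q : S × S => r q.2 := hr.comp measurable_snd
  have ha1 : Measurable fun q : S × S => a (ξ q.1) := (hc a).comp measurable_fst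
  have ha2 : Measurable fun q : S × S => a (ξ q.2) := (hc a).comp measurable_snd
  have he : ∀ q : S × S, inner ℝ (RKHS.kerFun H (ξ q.1) (r q.1) - a)
      (RKHS.kerFun H (ξ q.2) (r q.2) - a) =
      inner ℝ (RKHS.kernel H (ξ q.2) (ξ q.1) (r q.1)) (r q.2) - inner ℝ (r q.1) (a (ξ q.1))
        - (inner ℝ (a (ξ q.2)) (r q.2) - inner ℝ a a) := fun q => by
    rw [inner_sub_left, inner_sub_right, inner_sub_right, RKHS.kernel_inner,
      RKHS.kerFun_inner (f := a), RKHS.inner_kerFun (f := a)]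
  have h := (((hK.clm_apply_of_finiteDimensional hr1).inner hr2).sub (hr1.inner ha1)).sub
    ((ha2.inner hr2).sub_const (inner ℝ a a))
  exact (funext he : _ = _) ▸ h

end Consistency

lemma norm_sub_sq_le_two_mul {E : Type*} [NormedAddCommGroup E] (a b : E) :
    ‖a - b‖ ^ 2 ≤ 2 * ‖a‖ ^ 2 + 2 * ‖b‖ ^ 2 := by
  have h := norm_sub_le a b
  have h2 : ‖a - b‖ ^ 2 ≤ (‖a‖ + ‖b‖) ^ 2 := by gcongr
  nlinarith [sq_nonneg (‖a‖ - ‖b‖)]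

lemma lintegral_ofReal_const_add {α : Type*} [MeasurableSpace α] {μ : Measure α}
    [IsProbabilityMeasure μ] {c : ℝ} (hc : 0 ≤ c) {f : α → ℝ} (hf : Integrable f μ)
    (hf0 : ∀ a, 0 ≤ f a) :
    ∫⁻ a, ENNReal.ofReal (c + f a) ∂μ = ENNReal.ofReal (c + ∫ a, f a ∂μ) := by
  rw [← ofReal_integral_eq_lintegral_ofReal (f := fun a => c + f a) ((integrable_const c).add hf)
    (ae_of_all _ fun a => add_nonneg hc (hf0 a)), integral_add (integrable_const c) hf]
  simp

section Consistency

variable {S X V H : Type*} [MeasurableSpace S] {P : Measure S} [IsProbabilityMeasure P]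
  [NormedAddCommGroup V] [InnerProductSpace ℝ V] [FiniteDimensional ℝ V]
  [NormedAddCommGroup H] [InnerProductSpace ℝ H] [CompleteSpace H] [RKHS ℝ H X V]
  [TopologicalSpace X] [SecondCountableTopology X]
  [MeasurableSpace X] [BorelSpace X] {ξ : S → X} {Y : S → V} {y : X → V}

/-- The tower property replaces `Y` by `y`, and what remains is the population normal equation. -/
lemma integral_inner_residual_eq_zero (hH : IsC0Universal H) (hξ : Measurable ξ)
    (hY : MemLp Y 2 P) (hy : MemLp y 2 (P.map ξ))
    (hYy : ∀ h : H, ∫ s, inner ℝ (Y s) (h (ξ s)) ∂P = ∫ x, inner ℝ (y x) (h x) ∂(P.map ξ))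
    {lam : ℝ} {f₀ : H}
    (hf₀ : ∀ h : H, ∫ x, inner ℝ (y x - f₀ x) (h x) ∂(P.map ξ) = lam * inner ℝ f₀ h) (h : H) :
    ∫ s, inner ℝ (RKHS.kerFun H (ξ s) (Y s - f₀ (ξ s)) - lam • f₀) h ∂P = 0 := by
  have := Measure.isProbabilityMeasure_map (μ := P) hξ.aemeasurable
  have hm : ∀ f : H, MemLp (f : X → V) 2 (P.map ξ) := fun f => hH.memLp f
  have hmξ : ∀ f : H, MemLp (fun s => f (ξ s)) 2 P := fun f =>
    (hm f).comp_measurePreserving (hξ.measurePreserving P)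
  have hc : ∫ s, inner ℝ (f₀ (ξ s)) (h (ξ s)) ∂P = ∫ x, inner ℝ (f₀ x) (h x) ∂(P.map ξ) :=
    (integral_map hξ.aemeasurable (f := fun x => inner ℝ (f₀ x) (h x))
      ((hm f₀).1.inner (hm h).1)).symm
  have hpop := hf₀ h
  simp only [inner_sub_left] at hpop
  rw [integral_sub (hy.integrable_real_inner (hm h)) ((hm f₀).integrable_real_inner (hm h))] at hpop
  simp only [inner_sub_left, RKHS.kerFun_inner, inner_smul_left, conj_trivial]
  have i1 := hY.integrable_real_inner (hmξ h)
  have i2 := (hmξ f₀).integrable_real_inner (hmξ h)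
  have i3 : Integrable (fun s => inner ℝ (Y s) (h (ξ s)) - inner ℝ (f₀ (ξ s)) (h (ξ s))) P :=
    i1.sub i2
  rw [integral_sub i3 (integrable_const _), integral_sub i1 i2, hYy, hc, hpop]
  simp

variable [MeasurableSpace V] [BorelSpace V] [TopologicalSpace.MetrizableSpace X]

/-- The bound does not involve `f₀`: comparing its risk with that of the zero function gives `‖y -
f₀‖² ≤ b` in `L²` and `lam ‖f₀‖² ≤ b`, where `b` is the squared `L²` norm of `y`. -/
lemma integral_norm_residual_sq_le (hH : IsC0Universal H) {κ : ℝ}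
    (hκ : ∀ x : X, ‖RKHS.kerFun H x‖ ≤ κ) (hξ : Measurable ξ) (hYm : Measurable Y)
    (hY : MemLp Y 2 P) (hy : MemLp y 2 (P.map ξ)) {lam : ℝ} (hlam : 0 < lam) {f₀ : H}
    (hmin : ∫ x, ‖y x - f₀ x‖ ^ 2 ∂(P.map ξ) + lam * ‖f₀‖ ^ 2 ≤ ∫ x, ‖y x‖ ^ 2 ∂(P.map ξ)) :
    Integrable (fun s => ‖RKHS.kerFun H (ξ s) (Y s - f₀ (ξ s)) - lam • f₀‖ ^ 2) P ∧
      ∫ s, ‖RKHS.kerFun H (ξ s) (Y s - f₀ (ξ s)) - lam • f₀‖ ^ 2 ∂P ≤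
        2 * κ ^ 2 * (2 * ∫ s, ‖Y s‖ ^ 2 ∂P + 8 * ∫ x, ‖y x‖ ^ 2 ∂(P.map ξ))
          + 2 * (lam * ∫ x, ‖y x‖ ^ 2 ∂(P.map ξ)) := by
  have := Measure.isProbabilityMeasure_map (μ := P) hξ.aemeasurable
  set b := ∫ x, ‖y x‖ ^ 2 ∂(P.map ξ) with hb
  have hm : MemLp (f₀ : X → V) 2 (P.map ξ) := hH.memLp f₀
  have hmξ : MemLp (fun s => f₀ (ξ s)) 2 P := hm.comp_measurePreserving (hξ.measurePreserving P)
  have iY := (memLp_two_iff_integrable_sq_norm hY.1).1 hY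
  have iy := (memLp_two_iff_integrable_sq_norm hy.1).1 hy
  have if₀ := (memLp_two_iff_integrable_sq_norm hmξ.1).1 hmξ
  have if₀' := (memLp_two_iff_integrable_sq_norm hm.1).1 hm
  have isub : Integrable (fun x => ‖y x - f₀ x‖ ^ 2) (P.map ξ) :=
    (memLp_two_iff_integrable_sq_norm (hy.sub hm).1).1 (hy.sub hm)
  have hpt : ∀ s, ‖RKHS.kerFun H (ξ s) (Y s - f₀ (ξ s)) - lam • f₀‖ ^ 2 ≤
      2 * κ ^ 2 * (2 * ‖Y s‖ ^ 2 + 2 * ‖f₀ (ξ s)‖ ^ 2) + 2 * (lam ^ 2 * ‖f₀‖ ^ 2) := fun s => by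
    refine (norm_sub_sq_le_two_mul _ _).trans ?_
    rw [norm_smul, mul_pow, Real.norm_eq_abs, sq_abs, mul_assoc 2 (κ ^ 2)]
    gcongr
    calc ‖RKHS.kerFun H (ξ s) (Y s - f₀ (ξ s))‖ ^ 2
        ≤ (κ * ‖Y s - f₀ (ξ s)‖) ^ 2 := by
          gcongr
          exact (RKHS.kerFun H (ξ s)).le_of_opNorm_le (hκ _) _
      _ = κ ^ 2 * ‖Y s - f₀ (ξ s)‖ ^ 2 := mul_pow _ _ _
      _ ≤ _ := by gcongr; exact norm_sub_sq_le_two_mul _ _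
  have isum : Integrable (fun s => 2 * ‖Y s‖ ^ 2 + 2 * ‖f₀ (ξ s)‖ ^ 2) P :=
    (iY.const_mul 2).add (if₀.const_mul 2)
  have idom : Integrable (fun s => 2 * κ ^ 2 * (2 * ‖Y s‖ ^ 2 + 2 * ‖f₀ (ξ s)‖ ^ 2)
      + 2 * (lam ^ 2 * ‖f₀‖ ^ 2)) P :=
    (isum.const_mul _).add (integrable_const _)
  have hmeas : Measurable fun s =>
      ‖RKHS.kerFun H (ξ s) (Y s - f₀ (ξ s)) - lam • f₀‖ ^ 2 := by
    have h := (measurable_inner_residual hH hξ hYm f₀ (lam • f₀)).comp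
      (measurable_id.prodMk measurable_id : Measurable fun s : S => (s, s))
    simpa only [Function.comp_def, id, real_inner_self_eq_norm_sq] using h
  have hint : Integrable (fun s => ‖RKHS.kerFun H (ξ s) (Y s - f₀ (ξ s)) - lam • f₀‖ ^ 2) P :=
    idom.mono' hmeas.aestronglyMeasurable (ae_of_all _ fun s => by
      rw [Real.norm_of_nonneg (sq_nonneg _)]; exact hpt s)
  refine ⟨hint, (integral_mono hint idom hpt).trans ?_⟩
  have hval : ∫ s, (2 * κ ^ 2 * (2 * ‖Y s‖ ^ 2 + 2 * ‖f₀ (ξ s)‖ ^ 2)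
      + 2 * (lam ^ 2 * ‖f₀‖ ^ 2)) ∂P =
      2 * κ ^ 2 * (2 * ∫ s, ‖Y s‖ ^ 2 ∂P + 2 * ∫ s, ‖f₀ (ξ s)‖ ^ 2 ∂P)
        + 2 * (lam ^ 2 * ‖f₀‖ ^ 2) := by
    rw [integral_add (isum.const_mul _) (integrable_const _),
      integral_const_mul, integral_add (iY.const_mul 2) (if₀.const_mul 2), integral_const_mul,
      integral_const_mul]
    simp
  have hmap : ∫ s, ‖f₀ (ξ s)‖ ^ 2 ∂P = ∫ x, ‖f₀ x‖ ^ 2 ∂(P.map ξ) :=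
    (integral_map hξ.aemeasurable if₀'.1).symm
  -- Writing `f₀ = y - (y - f₀)` gives `2b + 2b`; this is the source of the `8` in the statement.
  have hf₀le : ∫ x, ‖f₀ x‖ ^ 2 ∂(P.map ξ) ≤ 4 * b := by
    calc ∫ x, ‖f₀ x‖ ^ 2 ∂(P.map ξ)
        ≤ ∫ x, (2 * ‖y x‖ ^ 2 + 2 * ‖y x - f₀ x‖ ^ 2) ∂(P.map ξ) := by
          refine integral_mono if₀' ((iy.const_mul 2).add (isub.const_mul 2)) fun x => ?_
          simpa using norm_sub_sq_le_two_mul (y x) (y x - f₀ x)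
      _ = 2 * b + 2 * ∫ x, ‖y x - f₀ x‖ ^ 2 ∂(P.map ξ) := by
          rw [integral_add (iy.const_mul 2) (isub.const_mul 2), integral_const_mul,
            integral_const_mul]
      _ ≤ 4 * b := by nlinarith [mul_nonneg hlam.le (sq_nonneg ‖f₀‖)]
  have hnorm : lam ^ 2 * ‖f₀‖ ^ 2 ≤ lam * b := by
    rw [sq, mul_assoc]
    refine mul_le_mul_of_nonneg_left ?_ hlam.le
    have : 0 ≤ ∫ x, ‖y x - f₀ x‖ ^ 2 ∂(P.map ξ) := integral_nonneg fun _ => sq_nonneg _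
    linarith
  rw [hval, hmap]
  have hκ2 := sq_nonneg κ
  have h8 : 2 * ∫ s, ‖Y s‖ ^ 2 ∂P + 2 * ∫ x, ‖f₀ x‖ ^ 2 ∂(P.map ξ)
      ≤ 2 * ∫ s, ‖Y s‖ ^ 2 ∂P + 8 * b := by linarith
  refine add_le_add (mul_le_mul_of_nonneg_left h8 (by positivity)) (by linarith)

/-- Measurability of `fhat` in the sample is not required: the error is dominated by a function of
the average of `ζ`, which is integrable, and the lower integral is monotone. -/
lemma lintegral_krr_error_le (hH : IsC0Universal H) {κ : ℝ}
    (hκ : ∀ x : X, ‖RKHS.kerFun H x‖ ≤ κ) (hξ : Measurable ξ) (hYm : Measurable Y)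
    (hY : MemLp Y 2 P) (hy : MemLp y 2 (P.map ξ))
    (hYy : ∀ h : H, ∫ s, inner ℝ (Y s) (h (ξ s)) ∂P = ∫ x, inner ℝ (y x) (h x) ∂(P.map ξ))
    {lam : ℝ} (hlam : 0 < lam) {f₀ : H}
    (hf₀ : ∀ h : H, ∫ x, inner ℝ (y x - f₀ x) (h x) ∂(P.map ξ) = lam * inner ℝ f₀ h)
    (hmin : ∫ x, ‖y x - f₀ x‖ ^ 2 ∂(P.map ξ) + lam * ‖f₀‖ ^ 2 ≤ ∫ x, ‖y x‖ ^ 2 ∂(P.map ξ))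
    {N : ℕ} (hN : N ≠ 0) {fhat : (Fin N → S) → H}
    (hfhat : ∀ᵐ D ∂(Measure.pi fun _ : Fin N => P), ∀ h : H,
      (1 / (N : ℝ)) * ∑ n, inner ℝ (Y (D n) - fhat D (ξ (D n))) (h (ξ (D n)))
        = lam * inner ℝ (fhat D) h) :
    ∫⁻ D, ∫⁻ x, ‖fhat D x - y x‖ₑ ^ 2 ∂(P.map ξ) ∂(Measure.pi fun _ : Fin N => P) ≤
      ENNReal.ofReal (2 * κ ^ 2 * (N * lam ^ 2)⁻¹ *
        (2 * κ ^ 2 * (2 * ∫ s, ‖Y s‖ ^ 2 ∂P + 8 * ∫ x, ‖y x‖ ^ 2 ∂(P.map ξ))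
          + 2 * (lam * ∫ x, ‖y x‖ ^ 2 ∂(P.map ξ)))
        + 2 * ∫ x, ‖y x - f₀ x‖ ^ 2 ∂(P.map ξ)) := by
  have := Measure.isProbabilityMeasure_map (μ := P) hξ.aemeasurable
  obtain ⟨hint, hle⟩ := integral_norm_residual_sq_le hH hκ hξ hYm hY hy hlam hmin
  set ζ : S → H := fun s => RKHS.kerFun H (ξ s) (Y s - f₀ (ξ s)) - lam • f₀ with hζ
  obtain ⟨havgi, havg⟩ := integral_norm_average_sq (P := P) (ζ := ζ)
    (measurable_inner_residual hH hξ hYm f₀ (lam • f₀)) hint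
    (integral_inner_residual_eq_zero hH hξ hY hy hYy hf₀) hN
  have hm : MemLp (f₀ : X → V) 2 (P.map ξ) := hH.memLp f₀
  have isub : Integrable (fun x => ‖y x - f₀ x‖ ^ 2) (P.map ξ) :=
    (memLp_two_iff_integrable_sq_norm (hy.sub hm).1).1 (hy.sub hm)
  set e := ∫ x, ‖y x - f₀ x‖ ^ 2 ∂(P.map ξ) with he
  have he0 : 0 ≤ e := integral_nonneg fun _ => sq_nonneg _
  set G : (Fin N → S) → ℝ := fun D => ‖(1 / (N : ℝ)) • ∑ n, ζ (D n)‖ ^ 2 with hG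
  have hG0 : ∀ D, 0 ≤ G D := fun D => sq_nonneg _
  have hD : ∀ᵐ D ∂(Measure.pi fun _ : Fin N => P),
      ∫⁻ x, ‖fhat D x - y x‖ₑ ^ 2 ∂(P.map ξ) ≤
        ENNReal.ofReal (2 * κ ^ 2 * (lam ^ 2)⁻¹ * G D + 2 * e) := by
    filter_upwards [hfhat] with D hD
    have h1 : lam * ‖fhat D - f₀‖ ≤ ‖(1 / (N : ℝ)) • ∑ n, ζ (D n)‖ :=
      norm_sub_le_of_krr_normalEquation hN hD f₀
    have h2 : ‖fhat D - f₀‖ ^ 2 ≤ (lam ^ 2)⁻¹ * G D := by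
      rw [inv_mul_eq_div, le_div_iff₀ (by positivity), mul_comm, ← mul_pow]
      exact pow_le_pow_left₀ (by positivity) h1 2
    -- The estimation error is controlled uniformly in `x` by `κ` times the norm of `H`; only the
    -- approximation error is left to integrate.
    have h3 : ∀ x, ‖fhat D x - y x‖ₑ ^ 2 ≤
        ENNReal.ofReal (2 * κ ^ 2 * (lam ^ 2)⁻¹ * G D + 2 * ‖y x - f₀ x‖ ^ 2) := fun x => by
      rw [← ofReal_norm, ← ENNReal.ofReal_pow (norm_nonneg _)]
      refine ENNReal.ofReal_le_ofReal ?_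
      have h4 : fhat D x - y x = (fhat D - f₀ : H) x - (y x - f₀ x) := by
        rw [RKHS.coe_sub, Pi.sub_apply]; abel
      rw [h4]
      refine (norm_sub_sq_le_two_mul _ _).trans (add_le_add ?_ le_rfl)
      calc 2 * ‖(fhat D - f₀ : H) x‖ ^ 2 ≤ 2 * (κ * ‖fhat D - f₀‖) ^ 2 := by
            gcongr; exact RKHS.norm_apply_le_of_norm_kerFun_le hκ _ x
        _ = 2 * κ ^ 2 * ‖fhat D - f₀‖ ^ 2 := by ring
        _ ≤ 2 * κ ^ 2 * ((lam ^ 2)⁻¹ * G D) := by gcongr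
        _ = _ := by ring
    refine (lintegral_mono h3).trans_eq ?_
    rw [lintegral_ofReal_const_add (mul_nonneg (by positivity) (hG0 D)) (isub.const_mul 2)
      fun x => by positivity, integral_const_mul]
  refine (lintegral_mono_ae hD).trans ?_
  have hGi : Integrable (fun D => 2 * κ ^ 2 * (lam ^ 2)⁻¹ * G D) (Measure.pi fun _ : Fin N => P) :=
    havgi.const_mul _
  simp only [add_comm _ (2 * e)]
  rw [lintegral_ofReal_const_add (by positivity) hGi
    fun D => mul_nonneg (by positivity) (hG0 D), integral_const_mul, havg]
  refine ENNReal.ofReal_le_ofReal (add_le_add le_rfl ?_)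
  calc 2 * κ ^ 2 * (lam ^ 2)⁻¹ * (1 / (N : ℝ) * ∫ s, ‖ζ s‖ ^ 2 ∂P)
      = 2 * κ ^ 2 * (N * lam ^ 2)⁻¹ * ∫ s, ‖ζ s‖ ^ 2 ∂P := by rw [mul_inv]; ring
    _ ≤ _ := by gcongr

theorem tendsto_krr_error [LocallyCompactSpace X] [(P.map ξ).Regular] (hH : IsC0Universal H)
    (hξ : Measurable ξ) (hYm : Measurable Y) (hY : MemLp Y 2 P) (hy : MemLp y 2 (P.map ξ))
    (hYy : ∀ h : H, ∫ s, inner ℝ (Y s) (h (ξ s)) ∂P = ∫ x, inner ℝ (y x) (h x) ∂(P.map ξ))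
    {lam : ℕ → ℝ} (hlam : ∀ N, 0 < lam N) (hlam0 : Tendsto lam atTop (𝓝 0))
    (hlamN : Tendsto (fun N : ℕ => (N : ℝ) * lam N ^ 2) atTop atTop)
    {fhat : (N : ℕ) → (Fin N → S) → H}
    (hfhat : ∀ N : ℕ, ∀ᵐ D ∂(Measure.pi fun _ : Fin N => P), ∀ h : H,
      (1 / (N : ℝ)) * ∑ n, inner ℝ (Y (D n) - fhat N D (ξ (D n))) (h (ξ (D n)))
        = lam N * inner ℝ (fhat N D) h) :
    Tendsto (fun N : ℕ => ∫⁻ D, ∫⁻ x, ‖fhat N D x - y x‖ₑ ^ 2 ∂(P.map ξ)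
      ∂(Measure.pi fun _ : Fin N => P)) atTop (𝓝 0) := by
  have := Measure.isProbabilityMeasure_map (μ := P) hξ.aemeasurable
  obtain ⟨κ, -, hκ⟩ := hH.exists_norm_kerFun_le
  choose f₀ hf₀ hmin using fun N => exists_population_ridge hH hy (hlam N)
  have hmin0 : ∀ N, ∫ x, ‖y x - f₀ N x‖ ^ 2 ∂(P.map ξ) + lam N * ‖f₀ N‖ ^ 2
      ≤ ∫ x, ‖y x‖ ^ 2 ∂(P.map ξ) := fun N => by simpa using hmin N 0
  have happrox : Tendsto (fun N => ∫ x, ‖y x - f₀ N x‖ ^ 2 ∂(P.map ξ)) atTop (𝓝 0) := by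
    refine tendsto_order.2 ⟨fun a ha => Eventually.of_forall fun N =>
      ha.trans_le (integral_nonneg fun _ => sq_nonneg _), fun ε hε => ?_⟩
    -- A fixed competitor `g` with risk at most `ε/2`: minimality of `f₀ N` costs only the extra
    -- `lam N ‖g‖²`, eventually below `ε/2`.
    obtain ⟨g, hg⟩ := hH.exists_integral_norm_sub_sq_le hy (half_pos hε)
    have ht : Tendsto (fun N => lam N * ‖g‖ ^ 2) atTop (𝓝 0) := by
      simpa using hlam0.mul_const (‖g‖ ^ 2)
    filter_upwards [ht.eventually (gt_mem_nhds (half_pos hε))] with N hN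
    have h1 := hmin N g
    have h2 : 0 ≤ lam N * ‖f₀ N‖ ^ 2 := mul_nonneg (hlam N).le (sq_nonneg _)
    linarith
  set a := ∫ s, ‖Y s‖ ^ 2 ∂P
  set b := ∫ x, ‖y x‖ ^ 2 ∂(P.map ξ)
  have hbound : Tendsto (fun N : ℕ => ENNReal.ofReal (2 * κ ^ 2 * (N * lam N ^ 2)⁻¹ *
      (2 * κ ^ 2 * (2 * a + 8 * b) + 2 * (lam N * b))
        + 2 * ∫ x, ‖y x - f₀ N x‖ ^ 2 ∂(P.map ξ))) atTop (𝓝 0) := by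
    rw [← ENNReal.ofReal_zero]
    refine (ENNReal.continuous_ofReal.tendsto 0).comp ?_
    have h1 := ((tendsto_inv_atTop_zero.comp hlamN).const_mul (2 * κ ^ 2)).mul
      (((hlam0.mul_const b).const_mul 2).const_add (2 * κ ^ 2 * (2 * a + 8 * b)))
    have h2 := h1.add (happrox.const_mul 2)
    simpa using h2
  refine tendsto_of_tendsto_of_tendsto_of_le_of_le' tendsto_const_nhds hbound
    (Eventually.of_forall fun _ => bot_le) ?_
  filter_upwards [eventually_ne_atTop 0] with N hN
  exact lintegral_krr_error_le hH hκ hξ hYm hY hy hYy (hlam N) (hf₀ N) (hmin0 N) hN (hfhat N)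

end Consistency

/-! ### The main theorem -/

theorem mainTheorem2 {p m d : ℕ} (NN : NeuralNetwork p m d) (θ : Param p d)
    -- the network is built from Lipschitz nonlinearities, and is differentiable in `w` at the
    -- current parameter for almost every `z`
    (hLip : NN.LipschitzNonlinearities)
    (hDiff : ∀ᵐ z : Vec m, DifferentiableAt ℝ (fun w => NN.eval w z) θ.weights)
    -- finite second moment of `NN_w(z)` under the prior
    (hMoment : MemLp (NN.eval θ.weights) 2 (priorLaw m))
    -- bounded spectral norms of the layers
    (B : ℝ) (hB : 0 < B) (hSpec : NN.SpectralNormLE θ.weights B)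
    -- the diagonal of `Σ` is bounded below
    (c : ℝ) (hc : 0 < c) (hVar : ∀ i, c ≤ θ.variance i) :
    -- the target is well defined and square-integrable under the marginal
    (∀ x, Integrable (fun z => scoreGradient NN θ z x) (posteriorLaw NN θ x)) ∧
    MemLp (gradientTarget NN θ) 2 (marginalLaw NN θ) ∧
    -- kernel ridge regression on `N` i.i.d. samples `(z, x)` from the model, regressing
    -- `∇_θ log p_θ(z,x)` on `x`, is consistent for the target
    (∀ (H : Type*) [NormedAddCommGroup H] [InnerProductSpace ℝ H] [CompleteSpace H]
      [RKHS ℝ H (Vec d) (Param p d)], IsC0Universal H →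
      ∀ lam : ℕ → ℝ, (∀ N, 0 < lam N) → Tendsto lam atTop (𝓝 0) →
        Tendsto (fun N : ℕ => (N : ℝ) * lam N ^ 2) atTop atTop →
      ∃ fhat : (N : ℕ) → (Fin N → Vec m × Vec d) → H,
        (∀ N D, IsKRREstimator (lam N) (fun n => (D n).2)
            (fun n => scoreGradient NN θ (D n).1 (D n).2) (fhat N D) ∧
          ∀ g : H, IsKRREstimator (lam N) (fun n => (D n).2)
            (fun n => scoreGradient NN θ (D n).1 (D n).2) g → g = fhat N D) ∧
        Tendsto (fun N : ℕ => ∫⁻ D, ∫⁻ x, ‖fhat N D x - gradientTarget NN θ x‖ₑ ^ 2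
            ∂(marginalLaw NN θ) ∂(Measure.pi fun _ : Fin N => jointLaw NN θ))
          atTop (𝓝 0)) := by
  have hθ : ∀ i, 0 < θ.variance i := fun i => hc.trans_le (hVar i)
  have hPprob := hLip.isProbabilityMeasure_jointLaw hθ
  have hmap := hLip.map_snd_jointLaw hθ
  have hy := hLip.memLp_integral_scoreFormula hθ
  have htarget : gradientTarget NN θ =
      fun x => ∫ z, scoreFormula NN θ z x ∂(posteriorLaw NN θ x) :=
    funext (gradientTarget_eq hDiff hθ)
  refine ⟨fun x => (hLip.integrable_scoreFormula hθ x).congr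
    (scoreGradient_ae_eq_posteriorLaw hDiff hθ x).symm, htarget ▸ hy, ?_⟩
  intro H _ _ _ _ hH lam hlam hlam0 hlamN
  -- The estimator is built from the actual gradient, for every sample, so that existence and
  -- uniqueness hold without exceptional sets.
  choose fhat hfhat hmin using fun (N : ℕ) (D : Fin N → Vec m × Vec d) =>
    exists_krr_normalEquation (H := H) (hlam N) (fun n => (D n).2)
      (fun n => scoreGradient NN θ (D n).1 (D n).2)
  refine ⟨fhat, fun N D => ⟨fun g _ => ?_, fun g hg => ?_⟩, ?_⟩
  · have := hmin N D g
    have : 0 ≤ lam N * ‖g - fhat N D‖ ^ 2 := mul_nonneg (hlam N).le (sq_nonneg _)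
    change krrObjective _ _ _ _ ≤ krrObjective _ _ _ _
    linarith
  · have h1 := hmin N D g
    have h2 : krrObjective (lam N) (fun n => (D n).2)
        (fun n => scoreGradient NN θ (D n).1 (D n).2) g ≤ _ := hg (Set.mem_univ (fhat N D))
    have h3 : lam N * ‖g - fhat N D‖ ^ 2 ≤ 0 := by linarith
    have h4 : ‖g - fhat N D‖ ^ 2 ≤ 0 := nonpos_of_mul_nonpos_right h3 (hlam N)
    exact sub_eq_zero.1 (norm_eq_zero.1 (pow_eq_zero_iff two_ne_zero |>.1
      (h4.antisymm (sq_nonneg _))))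
  · have hQprob := Measure.isProbabilityMeasure_map (μ := jointLaw NN θ)
      (measurable_snd (α := Vec m) (β := Vec d)).aemeasurable
    rw [htarget, ← hmap]
    rw [← hmap] at hy
    have hYm := measurable_scoreFormula hLip θ
    have hY := hLip.memLp_scoreFormula hθ
    refine tendsto_krr_error (P := jointLaw NN θ) (ξ := fun s : Vec m × Vec d => s.2)
      (Y := fun s : Vec m × Vec d => scoreFormula NN θ s.1 s.2)
      (y := fun x => ∫ z, scoreFormula NN θ z x ∂(posteriorLaw NN θ x))
      hH measurable_snd hYm hY hy (fun h => ?_) hlam hlam0 hlamN fun N => ?_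
    · have hh : MemLp (fun s : Vec m × Vec d => h s.2) 2 (jointLaw NN θ) :=
        MemLp.comp_measurePreserving (g := fun x : Vec d => h x) (f := Prod.snd) (hH.memLp h)
          (measurable_snd.measurePreserving (jointLaw NN θ))
      have hYh : Integrable (fun s : Vec m × Vec d =>
          inner ℝ (scoreFormula NN θ s.1 s.2) (h s.2)) (jointLaw NN θ) :=
        MemLp.integrable_real_inner (f := fun s : Vec m × Vec d => scoreFormula NN θ s.1 s.2)
          (g := fun s : Vec m × Vec d => h s.2) hY hh
      have hswap := hLip.integral_inner_scoreFormula hθ (h := fun x => h x) hYh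
      rw [hswap, hmap]
    -- Almost surely all `N` sampled gradients agree with the formula, so the normal equation of
    -- `fhat` holds with the formula as data.
    · have hae : ∀ᵐ D ∂(Measure.pi fun _ : Fin N => jointLaw NN θ), ∀ n,
          scoreGradient NN θ (D n).1 (D n).2 = scoreFormula NN θ (D n).1 (D n).2 :=
        ae_all_iff.2 fun n =>
          (Measure.quasiMeasurePreserving_eval (fun _ : Fin N => jointLaw NN θ) n).ae
            (p := fun s => scoreGradient NN θ s.1 s.2 = scoreFormula NN θ s.1 s.2)
            (scoreGradient_ae_eq_jointLaw hDiff hθ)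
      filter_upwards [hae] with D hD h
      simpa only [hD] using hfhat N D h
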